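/- Let $\mu$ be a probability measure on the unit circle $\partial\mathbb{D}$ that is not supported on a finite set. Let $\Phi_n$ be its monic orthogonal polynomials, $\varphi_n=\Phi_n/\|\Phi_n\|_{L^2(\mu)}$ the orthonormal polynomials, and $\alpha_n=-\overline{\Phi_{n+1}(0)}$ $(n\ge 0)$ its Verblunsky coefficients. Write $d\mu = w\,\frac{d\theta}{2\pi}+d\mu_{\mathrm s}$ with $\mu_{\mathrm s}$ singular with respect to $d\theta$. Suppose that the BLS condition holds: for some $b\in(0,1)$, $C\in\mathbb{C}$ and $\Delta\in(0,1)$, $$\alpha_n = C b^n + O((b\Delta)^n)\qquad (n\to\infty).$$ Then $w>0$ almost everywhere and $\log w$ is integrable, so that the Szegő function $$D(z)=\exp\Bigl(\frac{1}{4\pi}\int_0^{2\pi}\frac{e^{i\theta}+z}{e^{i\theta}-z}\,\log w(\theta)\,d\theta\Bigr),\qquad |z|<1,$$ is well defined, and there are constants $K$ and $0<\Delta_1<\Delta_2<1$ such that: (i) $D^{-1}$ has a meromorphic continuation, still written $D^{-1}$, to $\{|z|<(b\Delta_2)^{-1}\}$, which is analytic except at $z=1/b$. If $C\ne0$, it has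 a simple pole at $1/b$. In all cases $$C=-\Bigl[\lim_{z\to 1/b}(z^{-1}-b)\,D(z)^{-1}\Bigr]\overline{D(b)},$$ so that the singularity at $1/b$ is removable if $C=0$. (ii) For all $n\ge 0$ and all $z$ with $b\Delta_2<|z|<b\Delta_2^{-1}$, $$\Bigl|\varphi_n(z)-\overline{D(1/\bar z)^{-1}}\;z^n-\bar C\,(z-b)^{-1}D(z)^{-1}\,b^n\Bigr|\le K\,(b\Delta_1)^n .$$ At $z=b$ the poles of the two terms $\overline{D(1/\bar z)^{-1}}\,z^n$ and $\bar C(z-b)^{-1}D(z)^{-1}b^n$ cancel, and their sum there means its limit as $z\to b$. -/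

import Mathlib

open MeasureTheory Filter Topology Polynomial
open scoped ComplexConjugate

namespace OPUC

noncomputable section

/-- The unit circle carries its Borel σ-algebra. -/
instance instMeasurableSpaceCircle : MeasurableSpace Circle := borel Circle

instance instBorelSpaceCircle : BorelSpace Circle := ⟨rfl⟩

/-- A measure on the unit circle is nontrivial if it is not supported on a finite set. -/
def NontrivialMeasure (μ : Measure Circle) : Prop :=
  ∀ s : Set Circle, s.Finite → μ sᶜ ≠ 0

/-- The `L²(μ)` inner product of two polynomials, antilinear in the first slot. -/
def ip (μ : Measure Circle) (P Q : ℂ[X]) : ℂ :=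
  ∫ ζ : Circle, conj (P.eval (ζ : ℂ)) * Q.eval (ζ : ℂ) ∂μ

/-- The `L²(μ)` norm of a polynomial. -/
def pnorm (μ : Measure Circle) (P : ℂ[X]) : ℝ :=
  Real.sqrt (∫ ζ : Circle, ‖P.eval (ζ : ℂ)‖ ^ 2 ∂μ)

/-- The monic orthogonal polynomials `Φₙ` of `μ`: Gram–Schmidt (without normalization) applied to
`1, z, z², …` in `L²(μ)`. -/
def monicOP (μ : Measure Circle) : ℕ → ℂ[X]
  | n => X ^ n - ∑ k : Fin n,
      C (ip μ (monicOP μ k) (X ^ n) / ip μ (monicOP μ k) (monicOP μ k)) * monicOP μ k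
termination_by n => n
decreasing_by all_goals exact k.isLt

/-- The orthonormal polynomials `φₙ = Φₙ / ‖Φₙ‖`. -/
def orthonormalOP (μ : Measure Circle) (n : ℕ) : ℂ[X] :=
  C (((pnorm μ (monicOP μ n))⁻¹ : ℝ) : ℂ) * monicOP μ n

/-- The Verblunsky coefficients `αₙ = - conj (Φₙ₊₁(0))`. -/
def verblunsky (μ : Measure Circle) (n : ℕ) : ℂ :=
  -conj ((monicOP μ (n + 1)).eval 0)

/-- `αₙ = C bⁿ + O((bΔ)ⁿ)` for some `Δ ∈ (0,1)`. -/
def BLSCondition (α : ℕ → ℂ) (b : ℝ) (C : ℂ) : Prop :=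
  ∃ Δ : ℝ, 0 < Δ ∧ Δ < 1 ∧
    (fun n : ℕ => α n - C * (b : ℂ) ^ n) =O[atTop] (fun n : ℕ => (b * Δ) ^ n)

/-- Normalized arc length `dθ/2π` on the unit circle. -/
def arcMeasure : Measure Circle :=
  (ENNReal.ofReal (2 * Real.pi))⁻¹ •
    (volume.restrict (Set.Ioc 0 (2 * Real.pi))).map (fun θ : ℝ => Circle.exp θ)

/-- The density `w` of the absolutely continuous part, `dμ = w dθ/2π + dμ_s`. -/
def weight (μ : Measure Circle) (ζ : Circle) : ℝ :=
  (μ.rnDeriv arcMeasure ζ).toReal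

/-- The Szegő condition `∫ log w dθ/2π > -∞` (the positive part of `log w` is always integrable,
since `log w ≤ w`): `w > 0` almost everywhere and `log w` is integrable. -/
def SzegoCondition (μ : Measure Circle) : Prop :=
  (∀ᵐ ζ ∂arcMeasure, 0 < weight μ ζ) ∧
    Integrable (fun ζ => Real.log (weight μ ζ)) arcMeasure

/-- The Szegő function
`D(z) = exp ((1/4π) ∫ (e^{iθ} + z)/(e^{iθ} - z) log w(θ) dθ)`, for `|z| < 1`. -/
def szegoD (μ : Measure Circle) (z : ℂ) : ℂ :=
  Complex.exp ((1 / 2 : ℂ) * ∫ ζ : Circle,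
    (((ζ : ℂ) + z) / ((ζ : ℂ) - z)) * (Real.log (weight μ ζ) : ℂ) ∂arcMeasure)

/-- The leading term `conj (D(1/z̄))⁻¹ zⁿ + C̄ (z - b)⁻¹ D(z)⁻¹ bⁿ`, where `Dinv` stands for
(the continuation of) `D⁻¹`. -/
def leadingTerm (Dinv : ℂ → ℂ) (b : ℝ) (C : ℂ) (n : ℕ) (z : ℂ) : ℂ :=
  conj (Dinv (1 / conj z)) * z ^ n + conj C * (z - (b : ℂ))⁻¹ * Dinv z * (b : ℂ) ^ n

end

end OPUC

namespace OPUC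

noncomputable section

/-! ### The inner product on polynomials -/

/-! Write H = lim Φₙ* (`szegoLim`) and N = lim ‖Φₙ‖². By the Szegő recursion
(`monicOP_eq_szegoPoly`) everything reduces to estimates on Φₙ and Φₙ* driven by the coefficients α.
Telescoping gives Φₙ* = 1 - ∑_{j<n} αⱼ z Φⱼ. Since αⱼ = O(bʲ) and Φⱼ grows at most like |z|ʲ outside
the disc, H is analytic for |z| < 1/b, and product bounds keep it away from 0 on the closed unit
disc. The Bernstein–Szegő measures ‖Φₙ‖² |Φₙ*|⁻² dθ/2π share the moments of μ up to order n, so in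
the limit μ = N |H|⁻² dθ/2π (`eq_densityMeasure`). Hence log w is the real part of a holomorphic
function, and the Schwarz formula gives D = √N / H (`szego_of_expDecay`).

To continue H, use Φⱼ(z) = zʲ conj(Φⱼ*(1/z̄)): for |z| ≥ 1 the term αⱼ z Φⱼ(z) equals C bʲ zʲ⁺¹
conj(H(1/z̄)) up to O((bδ|z|)ʲ) (`BLSDecay.exists_resTerm_bound`). The geometric main part sums to
an explicit pole at 1/b whose strength involves C conj(H(b)), and the remainder converges up to |z|
< 1/(bδ).

Stopping the same sum at n gives an exact formula for Φₙ* (`BLSDecay.szegoDual_eq`). Its reflection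
in the circle expresses Φₙ as the two leading terms plus zⁿ times a conjugated tail
(`BLSDecay.szegoPoly_eq`), and that product is O((bδ)ⁿ) because the powers of |z| cancel. Passing to
φₙ costs only O(b²ⁿ), as ‖Φₙ‖ converges at that rate. The error is continuous at z = b, which forces
the two poles there to cancel. -/

lemma integrable_of_continuous (ν : Measure Circle) [IsFiniteMeasure ν] {f : Circle → ℂ}
    (hf : Continuous f) : Integrable f ν :=
  (BoundedContinuousFunction.mkOfCompact ⟨f, hf⟩).integrable ν

lemma continuous_eval_circle (P : ℂ[X]) : Continuous fun ζ : Circle => P.eval (ζ : ℂ) :=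
  P.continuous.comp continuous_subtype_val

lemma conj_coe_mul_coe (ζ : Circle) : conj (ζ : ℂ) * ζ = 1 := by
  rw [← Complex.normSq_eq_conj_mul_self]; simp

lemma integrable_ip (ν : Measure Circle) [IsFiniteMeasure ν] (P Q : ℂ[X]) :
    Integrable (fun ζ : Circle => conj (P.eval (ζ : ℂ)) * Q.eval (ζ : ℂ)) ν :=
  integrable_of_continuous ν
    ((Complex.continuous_conj.comp (continuous_eval_circle P)).mul (continuous_eval_circle Q))

/-- The inner product as a linear map in its second argument. -/
def ipLin (ν : Measure Circle) [IsFiniteMeasure ν] (P : ℂ[X]) : ℂ[X] →ₗ[ℂ] ℂ where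
  toFun := ip ν P
  map_add' Q R := by
    simp only [ip, eval_add, mul_add]
    exact integral_add (integrable_ip ν P Q) (integrable_ip ν P R)
  map_smul' c Q := by
    simp only [ip, eval_smul, smul_eq_mul, RingHom.id_apply, mul_left_comm _ c]
    exact integral_const_mul _ _

section

variable (ν : Measure Circle)

lemma conj_ip (P Q : ℂ[X]) : conj (ip ν P Q) = ip ν Q P := by
  simp only [ip, ← integral_conj, map_mul, Complex.conj_conj, mul_comm]

lemma ip_X_mul_X_mul (P Q : ℂ[X]) : ip ν (X * P) (X * Q) = ip ν P Q := by
  refine integral_congr_ae (Eventually.of_forall fun ζ => ?_)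
  simp only [eval_mul, eval_X, map_mul]
  linear_combination (conj (P.eval (ζ : ℂ)) * Q.eval (ζ : ℂ)) * conj_coe_mul_coe ζ

lemma ip_self (P : ℂ[X]) : ip ν P P = ((∫ ζ : Circle, ‖P.eval (ζ : ℂ)‖ ^ 2 ∂ν : ℝ) : ℂ) := by
  rw [ip, ← integral_complex_ofReal]
  refine integral_congr_ae (Eventually.of_forall fun ζ => ?_)
  simp [Complex.conj_mul']

variable [IsFiniteMeasure ν]

lemma ip_add_right (P Q R : ℂ[X]) : ip ν P (Q + R) = ip ν P Q + ip ν P R :=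
  (ipLin ν P).map_add Q R

lemma ip_sub_right (P Q R : ℂ[X]) : ip ν P (Q - R) = ip ν P Q - ip ν P R :=
  (ipLin ν P).map_sub Q R

lemma ip_C_mul_right (P Q : ℂ[X]) (c : ℂ) : ip ν P (C c * Q) = c * ip ν P Q := by
  rw [← smul_eq_C_mul]; exact (ipLin ν P).map_smul c Q

lemma ip_sum_right {ι : Type*} (s : Finset ι) (P : ℂ[X]) (f : ι → ℂ[X]) :
    ip ν P (∑ i ∈ s, f i) = ∑ i ∈ s, ip ν P (f i) :=
  map_sum (ipLin ν P) f s

lemma ip_add_left (P Q R : ℂ[X]) : ip ν (P + Q) R = ip ν P R + ip ν Q R := by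
  rw [← conj_ip, ip_add_right, map_add, conj_ip, conj_ip]

lemma ip_C_mul_left (P Q : ℂ[X]) (c : ℂ) : ip ν (C c * P) Q = conj c * ip ν P Q := by
  rw [← conj_ip, ip_C_mul_right, map_mul, conj_ip]

lemma ip_eq_zero_of_natDegree_lt {P Q : ℂ[X]} {n : ℕ} (hP : ∀ k < n, ip ν (X ^ k) P = 0)
    (hQ : Q.natDegree < n) : ip ν Q P = 0 := by
  rw [← conj_ip, Q.as_sum_range' n hQ, ip_sum_right, Finset.sum_eq_zero, map_zero]
  intro k hk
  rw [← C_mul_X_pow_eq_monomial, ip_C_mul_right, ← conj_ip, hP k (Finset.mem_range.1 hk)]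
  simp

variable {ν} in
-- Otherwise ν would be carried by the finitely many zeros of P on the circle.
lemma eq_zero_of_ip_self (hν : NontrivialMeasure ν) {P : ℂ[X]} (h : ip ν P P = 0) : P = 0 := by
  by_contra hP
  rw [ip_self, Complex.ofReal_eq_zero] at h
  have hint : Integrable (fun ζ : Circle => ‖P.eval (ζ : ℂ)‖ ^ 2) ν :=
    (BoundedContinuousFunction.mkOfCompact
      ⟨_, (continuous_eval_circle P).norm.pow 2⟩).integrable ν
  rw [integral_eq_zero_iff_of_nonneg (fun _ => by positivity) hint] at h
  refine hν {ζ : Circle | P.eval (ζ : ℂ) = 0} ?_ ?_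
  · refine Set.Finite.preimage (f := ((↑) : Circle → ℂ)) (Subtype.val_injective.injOn)
      (s := {z | P.eval z = 0}) ?_
    exact (P.rootSet_finite ℂ).subset fun z hz => by
      simpa [mem_rootSet, hP] using hz
  · refine measure_mono_null (fun ζ hζ => ?_) h
    simpa using hζ

end

/-! ### The Szegő recursion -/

/-- The polynomials `(Φₙ, Φₙ*)` generated from `(1, 1)` by the Szegő recursion with
coefficients `α`. -/
def szegoPair (α : ℕ → ℂ) : ℕ → ℂ[X] × ℂ[X]
  | 0 => (1, 1)
  | n + 1 => (X * (szegoPair α n).1 - C (conj (α n)) * (szegoPair α n).2,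
      (szegoPair α n).2 - C (α n) * (X * (szegoPair α n).1))

/-- The first component `Φₙ` of the Szegő recursion. -/
def szegoPoly (α : ℕ → ℂ) (n : ℕ) : ℂ[X] := (szegoPair α n).1

/-- The second component `Φₙ*` of the Szegő recursion. -/
def szegoDual (α : ℕ → ℂ) (n : ℕ) : ℂ[X] := (szegoPair α n).2

section

variable (α : ℕ → ℂ)

@[simp] lemma szegoPoly_zero : szegoPoly α 0 = 1 := rfl

@[simp] lemma szegoDual_zero : szegoDual α 0 = 1 := rfl

lemma szegoPoly_succ (n : ℕ) :
    szegoPoly α (n + 1) = X * szegoPoly α n - C (conj (α n)) * szegoDual α n := rfl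

lemma szegoDual_succ (n : ℕ) :
    szegoDual α (n + 1) = szegoDual α n - C (α n) * (X * szegoPoly α n) := rfl

lemma szego_degree (n : ℕ) : (szegoPoly α n).Monic ∧ (szegoPoly α n).natDegree = n ∧
    (szegoDual α n).natDegree ≤ n := by
  induction n with
  | zero => simp
  | succ n ih =>
    obtain ⟨h1, h2, h3⟩ := ih
    have hX : (X * szegoPoly α n).Monic := monic_X.mul h1
    have hXd : (X * szegoPoly α n).natDegree = n + 1 := by
      rw [natDegree_X_mul h1.ne_zero, h2]
    have hlt : (C (conj (α n)) * szegoDual α n).natDegree < (X * szegoPoly α n).natDegree := by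
      have := natDegree_C_mul_le (conj (α n)) (szegoDual α n)
      omega
    refine ⟨?_, ?_, ?_⟩
    · rw [szegoPoly_succ]
      exact hX.sub_of_left (degree_lt_degree hlt)
    · rw [szegoPoly_succ, natDegree_sub_eq_left_of_natDegree_lt hlt, hXd]
    · rw [szegoDual_succ]
      refine (natDegree_sub_le _ _).trans (max_le (by omega) ?_)
      exact (natDegree_C_mul_le _ _).trans hXd.le

lemma eval_zero_szegoDual (n : ℕ) : (szegoDual α n).eval 0 = 1 := by
  induction n with
  | zero => simp
  | succ n ih => simp [szegoDual_succ, ih]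

/-- The two lines of the recursion are exchanged by the reversal P ↦ zⁿ conj(P(1/z̄)), so both
identities must be carried through the induction together. -/
lemma szego_reflection (n : ℕ) {z : ℂ} (hz : z ≠ 0) :
    (szegoPoly α n).eval z = z ^ n * conj ((szegoDual α n).eval (conj z)⁻¹) ∧
    (szegoDual α n).eval z = z ^ n * conj ((szegoPoly α n).eval (conj z)⁻¹) := by
  induction n with
  | zero => simp
  | succ n ih =>
    obtain ⟨h1, h2⟩ := ih
    simp only [szegoPoly_succ, szegoDual_succ, eval_sub, eval_mul, eval_X, eval_C, map_sub,
      map_mul, map_inv₀, Complex.conj_conj]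
    constructor
    · rw [h1, h2, pow_succ]; field_simp
    · rw [h1, h2, pow_succ]; field_simp

lemma szegoPoly_reflection (n : ℕ) {z : ℂ} (hz : z ≠ 0) :
    (szegoPoly α n).eval z = z ^ n * conj ((szegoDual α n).eval (conj z)⁻¹) :=
  (szego_reflection α n hz).1

lemma szegoDual_circle (n : ℕ) (ζ : Circle) :
    (szegoDual α n).eval (ζ : ℂ) = (ζ : ℂ) ^ n * conj ((szegoPoly α n).eval (ζ : ℂ)) := by
  have h := (szego_reflection α n (z := (ζ : ℂ)) ζ.coe_ne_zero).2
  rwa [inv_eq_of_mul_eq_one_right (conj_coe_mul_coe ζ)] at h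

variable (ν : Measure Circle)

lemma ip_pow_szegoDual {k n : ℕ} (hk : k ≤ n) :
    ip ν (X ^ k) (szegoDual α n) = conj (ip ν (X ^ (n - k)) (szegoPoly α n)) := by
  rw [conj_ip]
  refine integral_congr_ae (Eventually.of_forall fun ζ => ?_)
  obtain ⟨m, rfl⟩ := Nat.exists_eq_add_of_le hk
  simp only [eval_pow, eval_X, szegoDual_circle, map_pow, pow_add, add_tsub_cancel_left]
  have : conj (ζ : ℂ) ^ k * (ζ : ℂ) ^ k = 1 := by
    rw [← mul_pow, conj_coe_mul_coe, one_pow]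
  linear_combination ((ζ : ℂ) ^ m * conj ((szegoPoly α (k + m)).eval (ζ : ℂ))) * this

lemma ip_szegoDual_self (n : ℕ) :
    ip ν (szegoDual α n) (szegoDual α n) = ip ν (szegoPoly α n) (szegoPoly α n) := by
  simp only [ip_self, szegoDual_circle, norm_mul, norm_pow, Circle.norm_coe, one_pow, one_mul,
    RCLike.norm_conj]

variable [IsFiniteMeasure ν]

/-- Downward induction step: the recursion is inverted to recover zΦₙ from Φₙ₊₁ and Φₙ₊₁*, which is
possible because |αₙ| < 1. It serves measures whose orthogonality is known directly only at the top
degree. -/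
lemma ip_szegoPoly_of_succ {n : ℕ} (hα : ‖α n‖ < 1)
    (h : ∀ k < n + 1, ip ν (X ^ k) (szegoPoly α (n + 1)) = 0) :
    ∀ k < n, ip ν (X ^ k) (szegoPoly α n) = 0 := by
  intro k hk
  have key : C (1 - conj (α n) * α n) * (X * szegoPoly α n) =
      szegoPoly α (n + 1) + C (conj (α n)) * szegoDual α (n + 1) := by
    rw [szegoPoly_succ, szegoDual_succ, C_sub, C_mul, C_1]; ring
  have h1 : (1 - conj (α n) * α n) * ip ν (X ^ k) (szegoPoly α n) = 0 := by
    rw [← ip_X_mul_X_mul, ← pow_succ', ← ip_C_mul_right, key, ip_add_right, ip_C_mul_right,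
      ip_pow_szegoDual α ν (by omega), h _ (by omega), h _ (by omega)]
    simp
  refine (mul_eq_zero.1 h1).resolve_left ?_
  rw [Complex.conj_mul', ← ne_eq, sub_ne_zero]
  norm_cast
  nlinarith [norm_nonneg (α n)]

/-- Pythagoras for zΦₙ = Φₙ₊₁ + conj(αₙ) Φₙ*, whose summands are orthogonal, together with ‖zΦₙ‖ =
‖Φₙ‖ = ‖Φₙ*‖. -/
lemma ip_szegoPoly_self_succ {n : ℕ}
    (h : ∀ k < n + 1, ip ν (X ^ k) (szegoPoly α (n + 1)) = 0) :
    ip ν (szegoPoly α (n + 1)) (szegoPoly α (n + 1)) =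
      ((1 - ‖α n‖ ^ 2 : ℝ) : ℂ) * ip ν (szegoPoly α n) (szegoPoly α n) := by
  have key : X * szegoPoly α n = szegoPoly α (n + 1) + C (conj (α n)) * szegoDual α n := by
    rw [szegoPoly_succ]; ring
  have h0 : ip ν (szegoDual α n) (szegoPoly α (n + 1)) = 0 :=
    ip_eq_zero_of_natDegree_lt ν h (Nat.lt_succ_of_le (szego_degree α n).2.2)
  have h0' : ip ν (szegoPoly α (n + 1)) (szegoDual α n) = 0 := by
    rw [← conj_ip, h0, map_zero]
  have h1 : ip ν (szegoPoly α n) (szegoPoly α n) = ip ν (szegoPoly α (n + 1)) (szegoPoly α (n + 1))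
      + α n * conj (α n) * ip ν (szegoPoly α n) (szegoPoly α n) := by
    have h2 := ip_X_mul_X_mul ν (szegoPoly α n) (szegoPoly α n)
    rw [key, ip_add_right, ip_add_left, ip_add_left, ip_C_mul_right,
      ip_C_mul_right, ip_C_mul_left, ip_C_mul_left, h0, h0', ip_szegoDual_self,
      Complex.conj_conj] at h2
    linear_combination -h2
  have h2 := Complex.mul_conj' (α n)
  push_cast
  linear_combination -h1 - ip ν (szegoPoly α n) (szegoPoly α n) * h2

end

/-! ### Gram–Schmidt -/

lemma monicOP_eq (μ : Measure Circle) (n : ℕ) :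
    monicOP μ n = X ^ n - ∑ k ∈ Finset.range n,
      C (ip μ (monicOP μ k) (X ^ n) / ip μ (monicOP μ k) (monicOP μ k)) * monicOP μ k := by
  rw [monicOP, Finset.sum_range]

lemma monicOP_degree (μ : Measure Circle) (n : ℕ) :
    (monicOP μ n).Monic ∧ (monicOP μ n).natDegree = n := by
  induction n using Nat.strong_induction_on with
  | _ n ih =>
    have hlt : (∑ k ∈ Finset.range n, C (ip μ (monicOP μ k) (X ^ n) /
        ip μ (monicOP μ k) (monicOP μ k)) * monicOP μ k).degree < (X ^ n : ℂ[X]).degree := by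
      rw [degree_X_pow]
      refine (degree_sum_le _ _).trans_lt ((Finset.sup_lt_iff (WithBot.bot_lt_coe n)).2 ?_)
      intro k hk
      rw [Finset.mem_range] at hk
      rw [← smul_eq_C_mul]
      refine (degree_smul_le _ _).trans_lt ?_
      rw [degree_eq_natDegree (ih k hk).1.ne_zero, (ih k hk).2]
      exact Nat.cast_lt.2 hk
    rw [monicOP_eq]
    refine ⟨(monic_X_pow n).sub_of_left hlt, ?_⟩
    rw [natDegree_eq_of_degree_eq (degree_sub_eq_left_of_degree_lt hlt), natDegree_X_pow]

lemma ip_self_eq_pnorm_sq (μ : Measure Circle) (P : ℂ[X]) : ip μ P P = ((pnorm μ P ^ 2 : ℝ) : ℂ) := by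
  rw [ip_self, pnorm, Real.sq_sqrt (integral_nonneg fun _ => by positivity)]

section

variable {μ : Measure Circle} [IsFiniteMeasure μ]

lemma ip_monicOP_self_ne_zero (hμ : NontrivialMeasure μ) (n : ℕ) :
    ip μ (monicOP μ n) (monicOP μ n) ≠ 0 :=
  fun h => (monicOP_degree μ n).1.ne_zero (eq_zero_of_ip_self hμ h)

lemma ip_monicOP_of_lt (hμ : NontrivialMeasure μ) (n : ℕ) :
    ∀ j < n, ip μ (monicOP μ j) (monicOP μ n) = 0 := by
  induction n using Nat.strong_induction_on with
  | _ n ih =>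
    intro j hj
    rw [monicOP_eq μ n, ip_sub_right, ip_sum_right, Finset.sum_eq_single j]
    · rw [ip_C_mul_right, div_mul_cancel₀ _ (ip_monicOP_self_ne_zero hμ j), sub_self]
    · intro k hk hkj
      rw [Finset.mem_range] at hk
      rw [ip_C_mul_right]
      rcases lt_or_gt_of_ne hkj with h | h
      · rw [← conj_ip μ (monicOP μ k) (monicOP μ j), ih j hj k h]; simp
      · rw [ih k hk j h]; simp
    · intro h; exact absurd (Finset.mem_range.2 hj) h

lemma ip_pow_monicOP (hμ : NontrivialMeasure μ) {k n : ℕ} (hk : k < n) :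
    ip μ (X ^ k) (monicOP μ n) = 0 := by
  have h : (X ^ k : ℂ[X]) = monicOP μ k + ∑ j ∈ Finset.range k,
      C (ip μ (monicOP μ j) (X ^ k) / ip μ (monicOP μ j) (monicOP μ j)) * monicOP μ j := by
    rw [monicOP_eq μ k]; ring
  rw [h, ip_add_left, ip_monicOP_of_lt hμ n k hk, zero_add, ← conj_ip, ip_sum_right,
    Finset.sum_eq_zero, map_zero]
  intro j hj
  rw [ip_C_mul_right, ← conj_ip μ (monicOP μ j) (monicOP μ n), ip_monicOP_of_lt hμ n j ((Finset.mem_range.1 hj).trans hk)]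
  simp

/-- **Szegő recursion** for the monic orthogonal polynomials of `μ`. -/
theorem monicOP_eq_szegoPoly (hμ : NontrivialMeasure μ) (n : ℕ) :
    monicOP μ n = szegoPoly (verblunsky μ) n := by
  induction n with
  | zero => rw [monicOP_eq]; simp
  | succ n ih =>
    set α := verblunsky μ
    have horth : ∀ k < n, ip μ (X ^ k) (szegoPoly α n) = 0 := fun k hk => by
      rw [← ih]; exact ip_pow_monicOP hμ hk
    -- Q has degree at most n, vanishes at 0 by the choice of αₙ, and is orthogonal to z, …, zⁿ.
    -- Hence Q = zR with deg R < n and R orthogonal to 1, …, zⁿ⁻¹, so R = 0.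
    set Q := monicOP μ (n + 1) - szegoPoly α (n + 1) with hQ
    have hQ0 : Q.eval 0 = 0 := by
      simp [hQ, szegoPoly_succ, eval_zero_szegoDual, α, verblunsky]
    have hQd : Q.natDegree < n + 1 := by
      have hm := monicOP_degree μ (n + 1)
      have hs := szego_degree α (n + 1)
      by_cases h0 : Q = 0
      · simp [h0]
      · rw [natDegree_lt_iff_degree_lt h0]
        have := degree_sub_lt_left (p := monicOP μ (n + 1)) (q := szegoPoly α (n + 1))
          (by rw [degree_eq_natDegree hm.1.ne_zero, degree_eq_natDegree hs.1.ne_zero, hm.2, hs.2.1])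
          hm.1.ne_zero (by rw [hm.1, hs.1])
        rwa [degree_eq_natDegree hm.1.ne_zero, hm.2] at this
    have hQo : ∀ k < n, ip μ (X ^ (k + 1)) Q = 0 := by
      intro k hk
      rw [hQ, szegoPoly_succ, ip_sub_right, ip_sub_right, ip_C_mul_right,
        ip_pow_monicOP hμ (by omega), pow_succ', ip_X_mul_X_mul, horth k hk, ← pow_succ',
        ip_pow_szegoDual α μ (by omega), horth _ (by omega)]
      simp
    obtain ⟨R, hR⟩ : X ∣ Q := by rwa [X_dvd_iff, coeff_zero_eq_eval_zero]
    have hR0 : R = 0 := by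
      by_contra hne
      refine hne (eq_zero_of_ip_self hμ ?_)
      refine ip_eq_zero_of_natDegree_lt (n := n) μ (fun k hk => ?_) ?_
      · rw [← ip_X_mul_X_mul, ← hR, ← pow_succ']; exact hQo k hk
      · rw [hR, natDegree_X_mul hne] at hQd; omega
    rw [hR0, mul_zero] at hR
    exact sub_eq_zero.1 hR

lemma ip_pow_szegoPoly (hμ : NontrivialMeasure μ) {k n : ℕ} (hk : k < n) :
    ip μ (X ^ k) (szegoPoly (verblunsky μ) n) = 0 := by
  rw [← monicOP_eq_szegoPoly hμ]; exact ip_pow_monicOP hμ hk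

lemma pnorm_sq_pos (hμ : NontrivialMeasure μ) (n : ℕ) : 0 < pnorm μ (monicOP μ n) ^ 2 := by
  have h := ip_monicOP_self_ne_zero hμ n
  rw [ip_self, Complex.ofReal_ne_zero] at h
  have h0 : 0 ≤ ∫ ζ : Circle, ‖(monicOP μ n).eval (ζ : ℂ)‖ ^ 2 ∂μ :=
    integral_nonneg fun _ => by positivity
  rw [pnorm, Real.sq_sqrt h0]
  exact lt_of_le_of_ne h0 h.symm

lemma pnorm_sq_succ (hμ : NontrivialMeasure μ) (n : ℕ) :
    pnorm μ (monicOP μ (n + 1)) ^ 2 = (1 - ‖verblunsky μ n‖ ^ 2) * pnorm μ (monicOP μ n) ^ 2 := by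
  have h := ip_szegoPoly_self_succ (verblunsky μ) μ (n := n) fun k hk => ip_pow_szegoPoly hμ hk
  rw [← monicOP_eq_szegoPoly hμ, ← monicOP_eq_szegoPoly hμ, ip_self_eq_pnorm_sq,
    ip_self_eq_pnorm_sq] at h
  exact_mod_cast h

lemma norm_verblunsky_lt_one (hμ : NontrivialMeasure μ) (n : ℕ) : ‖verblunsky μ n‖ < 1 := by
  have h1 := pnorm_sq_pos hμ n
  have h2 := pnorm_sq_pos hμ (n + 1)
  rw [pnorm_sq_succ hμ] at h2
  have h3 := pos_of_mul_pos_left h2 h1.le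
  nlinarith [norm_nonneg (verblunsky μ n)]

end

/-- `∏_{j < n} (1 - |αⱼ|²)`. -/
def normProd (α : ℕ → ℂ) (n : ℕ) : ℝ := ∏ j ∈ Finset.range n, (1 - ‖α j‖ ^ 2)

lemma pnorm_monicOP_sq {μ : Measure Circle} [IsProbabilityMeasure μ] (hμ : NontrivialMeasure μ)
    (n : ℕ) : pnorm μ (monicOP μ n) ^ 2 = normProd (verblunsky μ) n := by
  induction n with
  | zero =>
    rw [monicOP_eq]
    simp [pnorm, normProd]
  | succ n ih => rw [pnorm_sq_succ hμ, ih, normProd, normProd, Finset.prod_range_succ, mul_comm]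

lemma pnorm_monicOP {μ : Measure Circle} [IsProbabilityMeasure μ] (hμ : NontrivialMeasure μ)
    (n : ℕ) : pnorm μ (monicOP μ n) = √(normProd (verblunsky μ) n) := by
  rw [← pnorm_monicOP_sq hμ, Real.sqrt_sq]
  exact Real.sqrt_nonneg _

/-! ### Bounds on the polynomials of the Szegő recursion -/

/-- The step matrix preserves the indefinite form |v|² - |u|² up to the factor 1 - |a|²; this is
what propagates |Φₙ| ≤ |Φₙ*| on the disc. -/
lemma normSq_szego_step (a u v : ℂ) :
    ‖v - a * u‖ ^ 2 - ‖u - conj a * v‖ ^ 2 = (1 - ‖a‖ ^ 2) * (‖v‖ ^ 2 - ‖u‖ ^ 2) := by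
  simp only [← Complex.normSq_eq_norm_sq, Complex.normSq_apply, Complex.sub_re, Complex.sub_im,
    Complex.mul_re, Complex.mul_im, Complex.conj_re, Complex.conj_im]
  ring

section

variable {α : ℕ → ℂ}

lemma norm_szegoPoly_le_szegoDual (hα : ∀ n, ‖α n‖ < 1) {z : ℂ} (hz : ‖z‖ ≤ 1) (n : ℕ) :
    ‖(szegoPoly α n).eval z‖ ≤ ‖(szegoDual α n).eval z‖ := by
  induction n with
  | zero => simp
  | succ n ih =>
    simp only [szegoPoly_succ, szegoDual_succ, eval_sub, eval_mul, eval_X, eval_C]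
    set A := (szegoPoly α n).eval z
    set B := (szegoDual α n).eval z
    have h1 : ‖z * A‖ ≤ ‖B‖ := by
      rw [norm_mul]
      exact (mul_le_of_le_one_left (norm_nonneg _) hz).trans ih
    have h2 := normSq_szego_step (α n) (z * A) B
    have h3 : 0 ≤ (1 - ‖α n‖ ^ 2) * (‖B‖ ^ 2 - ‖z * A‖ ^ 2) := by
      refine mul_nonneg ?_ ?_
      · nlinarith [hα n, norm_nonneg (α n)]
      · nlinarith [norm_nonneg (z * A)]
    exact (pow_le_pow_iff_left₀ (norm_nonneg _) (norm_nonneg _) two_ne_zero).1 (by linarith)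

lemma szegoDual_le_prod (hα : ∀ n, ‖α n‖ < 1) {z : ℂ} (hz : ‖z‖ ≤ 1) (n : ℕ) :
    ‖(szegoDual α n).eval z‖ ≤ ∏ j ∈ Finset.range n, (1 + ‖α j‖) ∧
    ∏ j ∈ Finset.range n, (1 - ‖α j‖) ≤ ‖(szegoDual α n).eval z‖ := by
  induction n with
  | zero => simp
  | succ n ih =>
    rw [Finset.prod_range_succ, Finset.prod_range_succ]
    simp only [szegoDual_succ, eval_sub, eval_mul, eval_X, eval_C]
    have h0 := norm_szegoPoly_le_szegoDual hα hz n
    set A := (szegoPoly α n).eval z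
    set B := (szegoDual α n).eval z
    have h1 : ‖α n * (z * A)‖ ≤ ‖α n‖ * ‖B‖ := by
      rw [norm_mul, norm_mul]
      gcongr
      exact (mul_le_of_le_one_left (norm_nonneg _) hz).trans h0
    have h2 := norm_sub_le B (α n * (z * A))
    have h3 := norm_sub_norm_le B (α n * (z * A))
    have h4 := mul_le_mul_of_nonneg_right ih.1 (by positivity : 0 ≤ 1 + ‖α n‖)
    have h5 := mul_le_mul_of_nonneg_right ih.2 (sub_nonneg.2 (hα n).le)
    constructor <;> linarith

lemma exists_prod_bounds (hα : ∀ n, ‖α n‖ < 1) (hs : Summable fun n => ‖α n‖) :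
    ∃ K c : ℝ, 0 < K ∧ 0 < c ∧ ∀ n, ∏ j ∈ Finset.range n, (1 + ‖α j‖) ≤ K ∧
      c ≤ ∏ j ∈ Finset.range n, (1 - ‖α j‖) := by
  -- Chosen so that (1 - |αⱼ|)⁻¹ = 1 + tⱼ ≤ exp tⱼ; it is summable because tⱼ ≤ 2|αⱼ| once |αⱼ| ≤
  -- 1/2.
  set t : ℕ → ℝ := fun j => ‖α j‖ / (1 - ‖α j‖) with ht
  have hpos : ∀ j, 0 < 1 - ‖α j‖ := fun j => sub_pos.2 (hα j)
  have ht0 : ∀ j, 0 ≤ t j := fun j => div_nonneg (norm_nonneg _) (hpos j).le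
  have hts : Summable t := by
    refine Summable.of_norm_bounded_eventually_nat (hs.mul_left 2) ?_
    filter_upwards [hs.tendsto_atTop_zero.eventually (ge_mem_nhds (by norm_num : (0 : ℝ) < 1 / 2))]
      with j hj
    rw [Real.norm_of_nonneg (ht0 j), ht, div_le_iff₀ (hpos j)]
    nlinarith [norm_nonneg (α j)]
  refine ⟨Real.exp (∑' j, ‖α j‖), Real.exp (-∑' j, t j), Real.exp_pos _, Real.exp_pos _,
    fun n => ⟨?_, ?_⟩⟩
  · calc ∏ j ∈ Finset.range n, (1 + ‖α j‖) ≤ ∏ j ∈ Finset.range n, Real.exp ‖α j‖ :=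
          Finset.prod_le_prod (fun _ _ => by positivity) fun j _ => by
            linarith [Real.add_one_le_exp ‖α j‖]
      _ = Real.exp (∑ j ∈ Finset.range n, ‖α j‖) := (Real.exp_sum _ _).symm
      _ ≤ _ := Real.exp_le_exp.2 (hs.sum_le_tsum _ fun _ _ => norm_nonneg _)
  · calc Real.exp (-∑' j, t j) ≤ Real.exp (∑ j ∈ Finset.range n, -t j) := by
          rw [Finset.sum_neg_distrib]
          exact Real.exp_le_exp.2 (neg_le_neg (hts.sum_le_tsum _ fun _ _ => ht0 _))
      _ = ∏ j ∈ Finset.range n, Real.exp (-t j) := Real.exp_sum _ _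
      _ ≤ _ := Finset.prod_le_prod (fun _ _ => (Real.exp_pos _).le) fun j _ => by
          rw [Real.exp_neg]
          refine inv_le_of_inv_le₀ (hpos j) ?_
          have h : (1 - ‖α j‖)⁻¹ = t j + 1 := by
            rw [ht]; field_simp [(hpos j).ne']; ring
          rw [h]
          exact Real.add_one_le_exp _

/-- Exponentially decaying Verblunsky coefficients. -/
structure ExpDecay (α : ℕ → ℂ) (b M : ℝ) : Prop where
  pos : 0 < b
  lt_one : b < 1
  norm_lt : ∀ n, ‖α n‖ < 1
  bound : ∀ n, ‖α n‖ ≤ M * b ^ n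

variable {b M : ℝ}

lemma ExpDecay.nonneg (h : ExpDecay α b M) : 0 ≤ M := by
  simpa using (norm_nonneg _).trans (h.bound 0)

lemma ExpDecay.summable (h : ExpDecay α b M) : Summable fun n => ‖α n‖ :=
  Summable.of_nonneg_of_le (fun _ => norm_nonneg _) h.bound
    ((summable_geometric_of_lt_one h.pos.le h.lt_one).mul_left M)

/-- Uniform bounds for the recursion: `K` bounds `Φₙ*` from above, `c` from below, on the closed
unit disc. -/
lemma ExpDecay.exists_bounds (h : ExpDecay α b M) : ∃ K c : ℝ, 0 < K ∧ 0 < c ∧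
    (∀ n z, ‖z‖ ≤ 1 → ‖(szegoDual α n).eval z‖ ≤ K ∧ c ≤ ‖(szegoDual α n).eval z‖ ∧
      ‖(szegoPoly α n).eval z‖ ≤ K) ∧
    (∀ n z, 1 ≤ ‖z‖ → ‖(szegoPoly α n).eval z‖ ≤ K * ‖z‖ ^ n) ∧
    ∀ n, c ≤ normProd α n ∧ normProd α n ≤ 1 := by
  obtain ⟨K, c, hK, hc, hb⟩ := exists_prod_bounds h.norm_lt h.summable
  have hd : ∀ n z, ‖z‖ ≤ 1 → ‖(szegoDual α n).eval z‖ ≤ K := fun n z hz =>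
    (szegoDual_le_prod h.norm_lt hz n).1.trans (hb n).1
  refine ⟨K, c, hK, hc, fun n z hz => ⟨hd n z hz,
    (hb n).2.trans (szegoDual_le_prod h.norm_lt hz n).2,
    (norm_szegoPoly_le_szegoDual h.norm_lt hz n).trans (hd n z hz)⟩, fun n z hz => ?_,
    fun n => ⟨(hb n).2.trans ?_, ?_⟩⟩
  · have hz0 : z ≠ 0 := norm_pos_iff.1 (by linarith)
    rw [szegoPoly_reflection α n hz0, norm_mul, norm_pow, RCLike.norm_conj, mul_comm]
    gcongr
    refine hd n _ ?_
    rw [norm_inv, RCLike.norm_conj]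
    exact inv_le_one_of_one_le₀ hz
  · refine Finset.prod_le_prod (fun j _ => sub_nonneg.2 (h.norm_lt j).le) fun j _ => ?_
    nlinarith [h.norm_lt j, norm_nonneg (α j)]
  · refine Finset.prod_le_one (fun j _ => ?_) fun j _ => ?_
    · nlinarith [h.norm_lt j, norm_nonneg (α j)]
    · nlinarith [norm_nonneg (α j)]

/-! ### The limit of `Φₙ*` -/

lemma szegoDual_eq_sub_sum (α : ℕ → ℂ) (n : ℕ) (z : ℂ) :
    (szegoDual α n).eval z = 1 - ∑ j ∈ Finset.range n, α j * z * (szegoPoly α j).eval z := by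
  induction n with
  | zero => simp
  | succ n ih =>
    rw [Finset.sum_range_succ, szegoDual_succ]
    simp only [eval_sub, eval_mul, eval_X, eval_C, ih]
    ring

/-- The limit of `Φₙ*`, where it exists. -/
def szegoLim (α : ℕ → ℂ) (z : ℂ) : ℂ := 1 - ∑' j, α j * z * (szegoPoly α j).eval z

@[simp] lemma szegoLim_zero (α : ℕ → ℂ) : szegoLim α 0 = 1 := by simp [szegoLim]

lemma ExpDecay.exists_term_bound (h : ExpDecay α b M) : ∃ K : ℝ, 0 < K ∧ ∀ r, 1 ≤ r →
    ∀ n z, ‖z‖ ≤ r → ‖α n * z * (szegoPoly α n).eval z‖ ≤ K * r * (b * r) ^ n := by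
  obtain ⟨K, c, hK, -, hd, ha, -⟩ := h.exists_bounds
  -- M may be 0; M + 1 keeps the constant strictly positive.
  refine ⟨(M + 1) * K, mul_pos (by linarith [h.nonneg]) hK, fun r hr n z hz => ?_⟩
  have hA : ‖(szegoPoly α n).eval z‖ ≤ K * r ^ n := by
    rcases le_total ‖z‖ 1 with h1 | h1
    · exact (hd n z h1).2.2.trans (le_mul_of_one_le_right hK.le (one_le_pow₀ hr))
    · exact (ha n z h1).trans (by gcongr)
  have hb : ‖α n‖ ≤ (M + 1) * b ^ n := (h.bound n).trans (by
    have := pow_nonneg h.pos.le n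
    gcongr; linarith)
  have hM := h.nonneg
  have hbp := pow_nonneg h.pos.le n
  rw [norm_mul, norm_mul]
  calc ‖α n‖ * ‖z‖ * ‖(szegoPoly α n).eval z‖ ≤ ((M + 1) * b ^ n) * r * (K * r ^ n) := by gcongr
    _ = _ := by rw [mul_pow]; ring

lemma ExpDecay.summable_term (h : ExpDecay α b M) {z : ℂ} (hz : ‖z‖ < b⁻¹) :
    Summable fun j => α j * z * (szegoPoly α j).eval z := by
  obtain ⟨K, hK, hb⟩ := h.exists_term_bound
  have hbp := h.pos
  have h1 : 1 < b⁻¹ := (one_lt_inv₀ h.pos).2 h.lt_one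
  have hr : max 1 ‖z‖ < b⁻¹ := max_lt h1 hz
  have hbr : b * max 1 ‖z‖ < 1 :=
    (mul_lt_mul_of_pos_left hr h.pos).trans_eq (mul_inv_cancel₀ h.pos.ne')
  exact Summable.of_norm_bounded
    ((summable_geometric_of_lt_one (by positivity) hbr).mul_left (K * max 1 ‖z‖))
    fun n => hb _ (le_max_left _ _) n z (le_max_right _ _)

lemma ExpDecay.tendsto_szegoDual (h : ExpDecay α b M) {z : ℂ} (hz : ‖z‖ < b⁻¹) :
    Tendsto (fun n => (szegoDual α n).eval z) atTop (𝓝 (szegoLim α z)) := by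
  simp only [szegoDual_eq_sub_sum]
  exact tendsto_const_nhds.sub (h.summable_term hz).hasSum.tendsto_sum_nat

lemma ExpDecay.exists_rate (h : ExpDecay α b M) : ∃ K : ℝ, 0 < K ∧ ∀ n z, ‖z‖ ≤ 1 →
    ‖(szegoDual α n).eval z - szegoLim α z‖ ≤ K * b ^ n := by
  obtain ⟨K, hK, hb⟩ := h.exists_term_bound
  refine ⟨K / (1 - b), div_pos hK (sub_pos.2 h.lt_one), fun n z hz => ?_⟩
  have hz' : ‖z‖ < b⁻¹ := hz.trans_lt ((one_lt_inv₀ h.pos).2 h.lt_one)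
  rw [← dist_eq_norm, div_mul_eq_mul_div]
  refine dist_le_of_le_geometric_of_tendsto b K h.lt_one (fun n => ?_) (h.tendsto_szegoDual hz') n
  rw [dist_eq_norm, szegoDual_succ]
  have := hb 1 le_rfl n z hz
  simpa [mul_assoc] using this

lemma ExpDecay.differentiableOn_szegoLim (h : ExpDecay α b M) :
    DifferentiableOn ℂ (szegoLim α) (Metric.ball 0 b⁻¹) := by
  obtain ⟨K, hK, hb⟩ := h.exists_term_bound
  have hbp := h.pos
  intro z hz
  rw [mem_ball_zero_iff] at hz
  have h1 : 1 < b⁻¹ := (one_lt_inv₀ h.pos).2 h.lt_one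
  obtain ⟨r, hr, hrb⟩ := exists_between (max_lt h1 hz)
  have hr1 : 1 < r := (le_max_left _ _).trans_lt hr
  have hbr : b * r < 1 :=
    (mul_lt_mul_of_pos_left hrb h.pos).trans_eq (mul_inv_cancel₀ h.pos.ne')
  have hd : DifferentiableOn ℂ (szegoLim α) (Metric.ball 0 r) := by
    refine (differentiableOn_const _).sub ?_
    refine Complex.differentiableOn_tsum_of_summable_norm
      (u := fun n => K * r * (b * r) ^ n)
      ((summable_geometric_of_lt_one (by positivity) hbr).mul_left _) (fun j => ?_)
      Metric.isOpen_ball (fun j w hw => hb r hr1.le j w (mem_ball_zero_iff.1 hw).le)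
    exact ((differentiableOn_const _).mul differentiableOn_id).mul
      (Polynomial.differentiable _).differentiableOn
  exact (hd.differentiableAt (Metric.isOpen_ball.mem_nhds
    (mem_ball_zero_iff.2 ((le_max_right _ _).trans_lt hr)))).differentiableWithinAt

lemma ExpDecay.exists_le_norm_szegoLim (h : ExpDecay α b M) : ∃ c : ℝ, 0 < c ∧
    ∀ z, ‖z‖ ≤ 1 → c ≤ ‖szegoLim α z‖ := by
  obtain ⟨K, c, hK, hc, hd, -⟩ := h.exists_bounds
  refine ⟨c, hc, fun z hz => ?_⟩
  have hz' : ‖z‖ < b⁻¹ := hz.trans_lt ((one_lt_inv₀ h.pos).2 h.lt_one)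
  exact ge_of_tendsto' (h.tendsto_szegoDual hz').norm fun n => (hd n z hz).2.1

lemma ExpDecay.szegoLim_ne_zero (h : ExpDecay α b M) {z : ℂ} (hz : ‖z‖ ≤ 1) :
    szegoLim α z ≠ 0 := by
  obtain ⟨c, hc, hd⟩ := h.exists_le_norm_szegoLim
  exact norm_pos_iff.1 (hc.trans_le (hd z hz))

/-! ### The limit of the norms -/

/-- The increments of the product are quadratic in αₙ, hence the rate b²ⁿ instead of bⁿ. The lower
bound c transfers this rate to the inverse square roots. -/
lemma ExpDecay.exists_normProd_lim (h : ExpDecay α b M) : ∃ N K c : ℝ, 0 < c ∧ c ≤ N ∧ 0 ≤ K ∧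
    (∀ n, c ≤ normProd α n) ∧
    Tendsto (normProd α) atTop (𝓝 N) ∧
    ∀ n, |(√(normProd α n))⁻¹ - (√N)⁻¹| ≤ K * (b ^ 2) ^ n := by
  obtain ⟨-, c, -, hc, -, -, hN⟩ := h.exists_bounds
  have hb2 : b ^ 2 < 1 := pow_lt_one₀ h.pos.le h.lt_one two_ne_zero
  have hstep : ∀ n, dist (normProd α n) (normProd α (n + 1)) ≤ M ^ 2 * (b ^ 2) ^ n := by
    intro n
    rw [Real.dist_eq, normProd, normProd, Finset.prod_range_succ, ← normProd]
    have h1 : normProd α n - normProd α n * (1 - ‖α n‖ ^ 2) = normProd α n * ‖α n‖ ^ 2 := by ring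
    have h2 : 0 ≤ normProd α n := hc.le.trans (hN n).1
    rw [h1, abs_of_nonneg (by positivity)]
    calc normProd α n * ‖α n‖ ^ 2 ≤ 1 * (M * b ^ n) ^ 2 := by
          gcongr
          · exact (hN n).2
          · exact h.bound n
      _ = _ := by ring
  obtain ⟨N, hlim⟩ := cauchySeq_tendsto_of_complete (cauchySeq_of_le_geometric _ _ hb2 hstep)
  have hcN : c ≤ N := ge_of_tendsto' hlim fun n => (hN n).1
  have hsc : 0 < √c := Real.sqrt_pos.2 hc
  refine ⟨N, M ^ 2 / (1 - b ^ 2) / √c ^ 3, c, hc, hcN, ?_, fun n => (hN n).1, hlim, fun n => ?_⟩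
  · have := sub_pos.2 hb2
    positivity
  have hd := dist_le_of_le_geometric_of_tendsto _ _ hb2 hstep hlim n
  rw [Real.dist_eq] at hd
  set x := √(normProd α n) with hx
  set y := √N with hy
  have hxc : √c ≤ x := Real.sqrt_le_sqrt (hN n).1
  have hyc : √c ≤ y := Real.sqrt_le_sqrt hcN
  have hx0 : 0 < x := hsc.trans_le hxc
  have hy0 : 0 < y := hsc.trans_le hyc
  have hx2 : normProd α n = x ^ 2 := (Real.sq_sqrt (hc.le.trans (hN n).1)).symm
  have hy2 : N = y ^ 2 := (Real.sq_sqrt (hc.le.trans hcN)).symm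
  have e1 : x⁻¹ - y⁻¹ = -((x ^ 2 - y ^ 2) / ((x + y) * (x * y))) := by
    field_simp; ring
  rw [e1, abs_neg, abs_div, ← hx2, ← hy2, abs_of_pos (by positivity : 0 < (x + y) * (x * y))]
  calc |normProd α n - N| / ((x + y) * (x * y))
      ≤ (M ^ 2 * (b ^ 2) ^ n / (1 - b ^ 2)) / (√c * (√c * √c)) := by
        gcongr
        linarith
    _ = _ := by ring

end

/-! ### Measures on the circle -/

/-- Finite measures on the circle with the same moments agree. -/
theorem measure_ext_of_moments {P Q : Measure Circle} [IsFiniteMeasure P] [IsFiniteMeasure Q]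
    (h : ∀ k : ℕ, ∫ ζ : Circle, (ζ : ℂ) ^ k ∂P = ∫ ζ : Circle, (ζ : ℂ) ^ k ∂Q) : P = Q := by
  have hz : ∀ k : ℤ, ∫ ζ : Circle, (ζ : ℂ) ^ k ∂P = ∫ ζ : Circle, (ζ : ℂ) ^ k ∂Q := by
    intro k
    obtain ⟨n, rfl | rfl⟩ := k.eq_nat_or_neg
    · simpa using h n
    · have e : ∀ ζ : Circle, (ζ : ℂ) ^ (-(n : ℤ)) = conj ((ζ : ℂ) ^ n) := fun ζ => by
        rw [zpow_neg, zpow_natCast, map_pow, ← inv_pow,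
          ← inv_eq_of_mul_eq_one_left (conj_coe_mul_coe ζ)]
      simp only [e, integral_conj, h n]
  let c : BoundedContinuousFunction Circle ℂ :=
    BoundedContinuousFunction.mkOfCompact ⟨fun ζ => (ζ : ℂ), continuous_subtype_val⟩
  let A : StarSubalgebra ℂ (BoundedContinuousFunction Circle ℂ) := StarAlgebra.adjoin ℂ {c}
  refine ext_of_forall_mem_subalgebra_integral_eq_of_polish (A := A) ?_ ?_
  · intro x y hxy
    refine ⟨fun ζ => (ζ : ℂ), ⟨_, ⟨c, StarAlgebra.subset_adjoin ℂ _ rfl, rfl⟩, rfl⟩, ?_⟩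
    exact fun he => hxy (Circle.ext he)
  · intro g hg
    -- The star algebra generated by ζ is spanned by words in ζ and ζ̄, each of which is an integer
    -- power of ζ on the circle.
    have hg' : g ∈ Submodule.span ℂ
        (Submonoid.closure ({c} ∪ star {c}) : Set (BoundedContinuousFunction Circle ℂ)) := by
      rw [← Algebra.adjoin_eq_span, ← StarAlgebra.adjoin_toSubalgebra]
      exact hg
    clear hg
    induction hg' using Submodule.span_induction with
    | mem x hx =>
      have hx' : ∃ k : ℤ, ∀ ζ : Circle, x ζ = (ζ : ℂ) ^ k := by
        induction hx using Submonoid.closure_induction with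
        | mem x hx =>
          rcases hx with hx | hx
          · rw [Set.mem_singleton_iff.1 hx]
            exact ⟨1, fun ζ => (zpow_one (ζ : ℂ)).symm⟩
          · rw [Set.star_singleton, Set.mem_singleton_iff] at hx
            refine ⟨-1, fun ζ => ?_⟩
            rw [hx, zpow_neg_one]
            exact eq_inv_of_mul_eq_one_left (conj_coe_mul_coe ζ)
        | one => exact ⟨0, fun ζ => by simp⟩
        | mul x y _ _ hx hy =>
          obtain ⟨k, hk⟩ := hx
          obtain ⟨l, hl⟩ := hy
          exact ⟨k + l, fun ζ => by
            rw [BoundedContinuousFunction.mul_apply, hk, hl, zpow_add₀ ζ.coe_ne_zero]⟩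
      obtain ⟨k, hk⟩ := hx'
      simp only [hk, hz k]
    | zero => simp
    | add x y _ _ hx hy =>
      simp only [BoundedContinuousFunction.add_apply]
      rw [integral_add (x.integrable P) (y.integrable P),
        integral_add (x.integrable Q) (y.integrable Q)]
      rw [hx, hy]
    | smul a x _ hx =>
      simp only [BoundedContinuousFunction.smul_apply, integral_smul]
      rw [hx]

lemma continuous_circle_exp : Continuous fun θ : ℝ => Circle.exp θ := Circle.exp.continuous

instance instIsProbabilityMeasureArc : IsProbabilityMeasure arcMeasure := by
  constructor
  rw [arcMeasure, Measure.smul_apply,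
    Measure.map_apply continuous_circle_exp.measurable MeasurableSet.univ]
  simp only [Set.preimage_univ, Measure.restrict_apply_univ, Real.volume_Ioc, sub_zero,
    smul_eq_mul]
  refine ENNReal.inv_mul_cancel ?_ ENNReal.ofReal_ne_top
  simp [Real.pi_pos]

lemma integral_arcMeasure {F : ℂ → ℂ} (hF : Continuous fun ζ : Circle => F ζ) :
    ∫ ζ : Circle, F ζ ∂arcMeasure = Real.circleAverage F 0 1 := by
  rw [arcMeasure, integral_smul_measure,
    integral_map continuous_circle_exp.aemeasurable hF.aestronglyMeasurable,
    Real.circleAverage_def, intervalIntegral.integral_of_le (by positivity)]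
  simp [circleMap, Circle.coe_exp, Real.pi_pos.le]

lemma integral_arcMeasure_of_diffContOnCl {F : ℂ → ℂ}
    (hF : DiffContOnCl ℂ F (Metric.ball 0 1)) : ∫ ζ : Circle, F ζ ∂arcMeasure = F 0 := by
  rw [integral_arcMeasure, DiffContOnCl.circleAverage (by simpa using hF)]
  have := hF.continuousOn
  rw [closure_ball 0 one_ne_zero] at this
  exact this.comp_continuous continuous_subtype_val fun ζ =>
    mem_closedBall_zero_iff.2 (Circle.norm_coe ζ).le

/-- The measure `g dθ/2π`. -/
def densityMeasure (g : Circle → ℝ) : Measure Circle :=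
  arcMeasure.withDensity fun ζ => ENNReal.ofReal (g ζ)

lemma isFiniteMeasure_densityMeasure {g : Circle → ℝ} (hg : Continuous g) :
    IsFiniteMeasure (densityMeasure g) :=
  isFiniteMeasure_withDensity_ofReal
    ((BoundedContinuousFunction.mkOfCompact ⟨g, hg⟩).integrable arcMeasure).2

lemma integral_densityMeasure {g : Circle → ℝ} (hg : Continuous g) (h0 : ∀ ζ, 0 ≤ g ζ)
    (f : Circle → ℂ) :
    ∫ ζ, f ζ ∂(densityMeasure g) = ∫ ζ, (g ζ : ℂ) * f ζ ∂arcMeasure := by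
  rw [densityMeasure, integral_withDensity_eq_integral_toReal_smul
    hg.measurable.ennreal_ofReal (by simp)]
  simp [ENNReal.toReal_ofReal, h0]

/-! ### Bernstein–Szegő measures -/

section

variable {α : ℕ → ℂ}

/-- The density of the `n`-th Bernstein–Szegő approximation. -/
def bernsteinSzego (α : ℕ → ℂ) (n : ℕ) (ζ : Circle) : ℝ :=
  normProd α n / ‖(szegoDual α n).eval (ζ : ℂ)‖ ^ 2

lemma szegoDual_ne_zero (hα : ∀ n, ‖α n‖ < 1) {z : ℂ} (hz : ‖z‖ ≤ 1) (n : ℕ) :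
    (szegoDual α n).eval z ≠ 0 :=
  norm_pos_iff.1 ((Finset.prod_pos fun j _ => sub_pos.2 (hα j)).trans_le
    (szegoDual_le_prod hα hz n).2)

lemma normProd_pos (hα : ∀ n, ‖α n‖ < 1) (n : ℕ) : 0 < normProd α n :=
  Finset.prod_pos fun j _ => by nlinarith [hα j, norm_nonneg (α j)]

lemma bernsteinSzego_nonneg (hα : ∀ n, ‖α n‖ < 1) (n : ℕ) (ζ : Circle) :
    0 ≤ bernsteinSzego α n ζ :=
  div_nonneg (normProd_pos hα n).le (by positivity)

lemma continuous_bernsteinSzego (hα : ∀ n, ‖α n‖ < 1) (n : ℕ) :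
    Continuous (bernsteinSzego α n) :=
  continuous_const.div ((continuous_eval_circle _).norm.pow 2) fun ζ =>
    pow_ne_zero 2 (norm_ne_zero_iff.2 (szegoDual_ne_zero hα (Circle.norm_coe ζ).le n))

/-- On the circle Φₙ / |Φₙ*|² = ζⁿ / Φₙ*, so the integrand is a constant times ζⁿ⁻ᵏ / Φₙ*. This is
holomorphic on the closed disc and vanishes at 0, and the mean value property applies. -/
lemma ip_pow_bernsteinSzego (hα : ∀ n, ‖α n‖ < 1) {k n : ℕ} (hk : k < n) :
    ip (densityMeasure (bernsteinSzego α n)) (X ^ k) (szegoPoly α n) = 0 := by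
  rw [ip, integral_densityMeasure (continuous_bernsteinSzego hα n) (bernsteinSzego_nonneg hα n)]
  obtain ⟨m, rfl⟩ := Nat.exists_eq_add_of_lt hk
  set F : ℂ → ℂ := fun z =>
    (normProd α (k + m + 1) : ℂ) * z ^ (m + 1) / (szegoDual α (k + m + 1)).eval z with hF
  have hF0 : F 0 = 0 := by simp [hF]
  have e : ∀ ζ : Circle, (bernsteinSzego α (k + m + 1) ζ : ℂ) * (conj ((X ^ k : ℂ[X]).eval (ζ : ℂ)) *
      (szegoPoly α (k + m + 1)).eval (ζ : ℂ)) =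
      F ζ := by
    intro ζ
    rw [hF]
    have hB := szegoDual_ne_zero hα (Circle.norm_coe ζ).le (k + m + 1)
    have h1 := szegoPoly_reflection α (k + m + 1) ζ.coe_ne_zero
    rw [inv_eq_of_mul_eq_one_right (conj_coe_mul_coe ζ)] at h1
    have h2 : conj (ζ : ℂ) ^ k * (ζ : ℂ) ^ k = 1 := by
      rw [← mul_pow, conj_coe_mul_coe, one_pow]
    simp only [bernsteinSzego, eval_pow, eval_X, map_pow, h1]
    push_cast
    rw [← Complex.mul_conj']
    have hB' := (map_ne_zero (starRingEnd ℂ)).2 hB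
    field_simp
    rw [add_assoc, pow_add _ k]
    linear_combination (normProd α (k + (m + 1)) : ℂ) * (ζ : ℂ) ^ (m + 1) * h2
  refine (integral_congr_ae (Eventually.of_forall e)).trans
    ((integral_arcMeasure_of_diffContOnCl ?_).trans hF0)
  refine DifferentiableOn.diffContOnCl fun z hz => ?_
  rw [closure_ball 0 one_ne_zero, mem_closedBall_zero_iff] at hz
  have hn : DifferentiableAt ℂ (fun z : ℂ => (normProd α (k + m + 1) : ℂ) * z ^ (m + 1)) z := by
    fun_prop
  exact (hn.div (Polynomial.differentiableAt _)
    (szegoDual_ne_zero hα hz _)).differentiableWithinAt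

lemma ip_self_bernsteinSzego (hα : ∀ n, ‖α n‖ < 1) (n : ℕ) :
    ip (densityMeasure (bernsteinSzego α n)) (szegoPoly α n) (szegoPoly α n) = normProd α n := by
  rw [ip, integral_densityMeasure (continuous_bernsteinSzego hα n) (bernsteinSzego_nonneg hα n)]
  have e : ∀ ζ : Circle, (bernsteinSzego α n ζ : ℂ) * (conj ((szegoPoly α n).eval (ζ : ℂ)) *
      (szegoPoly α n).eval (ζ : ℂ)) = normProd α n := by
    intro ζ
    have hB := szegoDual_ne_zero hα (Circle.norm_coe ζ).le n
    have h1 : ‖(szegoDual α n).eval (ζ : ℂ)‖ = ‖(szegoPoly α n).eval (ζ : ℂ)‖ := by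
      rw [szegoDual_circle, norm_mul, norm_pow, Circle.norm_coe, one_pow, one_mul,
        RCLike.norm_conj]
    have h2 : (‖(szegoPoly α n).eval (ζ : ℂ)‖ : ℂ) ≠ 0 := by
      rw [← h1]; exact_mod_cast norm_ne_zero_iff.2 hB
    rw [Complex.conj_mul', bernsteinSzego, h1]
    push_cast
    field_simp
  simp [e]

/-- Descend from degree n, where both claims are direct computations, with the inverted recursion.
At m = 0 this also gives the total mass 1. -/
lemma bernsteinSzego_orthogonal (hα : ∀ n, ‖α n‖ < 1) {m n : ℕ} (hmn : m ≤ n) :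
    (∀ k < m, ip (densityMeasure (bernsteinSzego α n)) (X ^ k) (szegoPoly α m) = 0) ∧
      ip (densityMeasure (bernsteinSzego α n)) (szegoPoly α m) (szegoPoly α m) = normProd α m := by
  have := isFiniteMeasure_densityMeasure (continuous_bernsteinSzego hα n)
  induction hmn using Nat.decreasingInduction with
  | self => exact ⟨fun k hk => ip_pow_bernsteinSzego hα hk, ip_self_bernsteinSzego hα n⟩
  | of_succ m hm ih =>
    refine ⟨ip_szegoPoly_of_succ α _ (hα m) ih.1, ?_⟩
    have h := ip_szegoPoly_self_succ α _ ih.1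
    rw [ih.2, normProd, Finset.prod_range_succ, ← normProd, Complex.ofReal_mul, mul_comm] at h
    refine (mul_left_cancel₀ ?_ h).symm
    rw [Complex.ofReal_ne_zero]
    nlinarith [hα m, norm_nonneg (α m)]

/-- Orthogonality of the monic Φₖ to 1 expresses the k-th moment through the lower ones, with
coefficients depending on α only. -/
lemma ip_one_pow_eq {P Q : Measure Circle} [IsFiniteMeasure P] [IsFiniteMeasure Q] {n : ℕ}
    (hP : ∀ m ≤ n, 0 < m → ip P 1 (szegoPoly α m) = 0)
    (hQ : ∀ m ≤ n, 0 < m → ip Q 1 (szegoPoly α m) = 0) (h1 : ip P 1 1 = ip Q 1 1) :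
    ∀ k ≤ n, ip P 1 (X ^ k) = ip Q 1 (X ^ k) := by
  intro k
  induction k using Nat.strong_induction_on with
  | _ k ih =>
    intro hk
    rcases Nat.eq_zero_or_pos k with rfl | hk0
    · simpa using h1
    have hd := szego_degree α k
    have e : X ^ k = szegoPoly α k - ∑ i ∈ Finset.range k,
        C ((szegoPoly α k).coeff i) * X ^ i := by
      have hc : (szegoPoly α k).coeff k = 1 := by
        have := hd.1.coeff_natDegree
        rwa [hd.2.1] at this
      have hs := (szegoPoly α k).as_sum_range' (k + 1) (by omega)
      simp only [← C_mul_X_pow_eq_monomial] at hs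
      rw [Finset.sum_range_succ, hc, C_1, one_mul] at hs
      exact eq_sub_of_add_eq' hs.symm
    rw [e, ip_sub_right, ip_sub_right, hP k hk hk0, hQ k hk hk0, ip_sum_right, ip_sum_right]
    congr 1
    refine Finset.sum_congr rfl fun i hi => ?_
    rw [ip_C_mul_right, ip_C_mul_right, ih i (Finset.mem_range.1 hi)
      ((Finset.mem_range.1 hi).le.trans hk)]

end

lemma moments_bernsteinSzego {μ : Measure Circle} [IsProbabilityMeasure μ]
    (hμ : NontrivialMeasure μ) {k n : ℕ} (hk : k ≤ n) :
    ∫ ζ : Circle, (ζ : ℂ) ^ k ∂(densityMeasure (bernsteinSzego (verblunsky μ) n)) =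
      ∫ ζ : Circle, (ζ : ℂ) ^ k ∂μ := by
  have hα := norm_verblunsky_lt_one hμ
  have := isFiniteMeasure_densityMeasure (continuous_bernsteinSzego hα n)
  have h := ip_one_pow_eq (α := verblunsky μ) (Q := μ) (n := n)
    (P := densityMeasure (bernsteinSzego (verblunsky μ) n))
    (fun m hm h0 => by simpa using (bernsteinSzego_orthogonal hα hm).1 0 h0)
    (fun m _ h0 => by simpa using ip_pow_szegoPoly hμ h0)
    (by
      have := (bernsteinSzego_orthogonal hα (Nat.zero_le n)).2
      rw [szegoPoly_zero] at this
      rw [this]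
      simp [ip, normProd]) k hk
  simpa [ip] using h

/-- A measure with exponentially decaying Verblunsky coefficients has density `N |H|⁻²`, where
`H = lim Φₙ*` and `N = lim ‖Φₙ‖²`. -/
theorem eq_densityMeasure {μ : Measure Circle} [IsProbabilityMeasure μ]
    (hμ : NontrivialMeasure μ) {b M N : ℝ} (h : ExpDecay (verblunsky μ) b M)
    (hN : Tendsto (normProd (verblunsky μ)) atTop (𝓝 N)) (hN0 : 0 ≤ N)
    (hc : Continuous fun ζ : Circle => N / ‖szegoLim (verblunsky μ) ζ‖ ^ 2) :
    μ = densityMeasure fun ζ => N / ‖szegoLim (verblunsky μ) ζ‖ ^ 2 := by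
  have hα := norm_verblunsky_lt_one hμ
  have := isFiniteMeasure_densityMeasure hc
  obtain ⟨K, c, -, hc0, hd, -, hn⟩ := h.exists_bounds
  refine measure_ext_of_moments fun k => ?_
  rw [integral_densityMeasure hc fun ζ => by positivity]
  have hlim : Tendsto (fun n => ∫ ζ : Circle, (bernsteinSzego (verblunsky μ) n ζ : ℂ) *
      (ζ : ℂ) ^ k ∂arcMeasure) atTop (𝓝 (∫ ζ : Circle,
        ((N / ‖szegoLim (verblunsky μ) ζ‖ ^ 2 : ℝ) : ℂ) * (ζ : ℂ) ^ k ∂arcMeasure)) := by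
    refine tendsto_integral_of_dominated_convergence (fun _ => 1 / c ^ 2) (fun n => ?_)
      (integrable_const _) (fun n => Eventually.of_forall fun ζ => ?_)
      (Eventually.of_forall fun ζ => ?_)
    · exact ((Complex.continuous_ofReal.comp (continuous_bernsteinSzego hα n)).mul
        (continuous_subtype_val.pow k)).aestronglyMeasurable
    · rw [norm_mul, norm_pow, Circle.norm_coe, one_pow, mul_one, Complex.norm_real,
        Real.norm_of_nonneg (bernsteinSzego_nonneg hα n ζ), bernsteinSzego]
      have := (hd n ζ (Circle.norm_coe ζ).le).2.1
      gcongr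
      exact (hn n).2
    · refine Tendsto.mul_const _ ((Complex.continuous_ofReal.tendsto _).comp ?_)
      refine hN.div ((h.tendsto_szegoDual ?_).norm.pow 2) ?_
      · rw [Circle.norm_coe]; exact (one_lt_inv₀ h.pos).2 h.lt_one
      · exact pow_ne_zero 2 (norm_ne_zero_iff.2 (h.szegoLim_ne_zero (Circle.norm_coe ζ).le))
  refine tendsto_nhds_unique ?_ hlim
  refine tendsto_const_nhds.congr' ?_
  -- The k-th moments of the approximations are constant in n from n = k on.
  filter_upwards [eventually_ge_atTop k] with n hk
  rw [← moments_bernsteinSzego hμ hk,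
    integral_densityMeasure (continuous_bernsteinSzego hα n) (bernsteinSzego_nonneg hα n)]

/-! ### The Szegő function -/

/-- **Schwarz integral formula** on the unit disc. -/
theorem integral_schwarz {L : ℂ → ℂ} (hL : ∀ w, ‖w‖ ≤ 1 → DifferentiableAt ℂ L w)
    (h0 : (L 0).im = 0) {z : ℂ} (hz : ‖z‖ < 1) :
    ∫ ζ : Circle, (((ζ : ℂ) + z) / ((ζ : ℂ) - z)) * ((L ζ).re : ℂ) ∂arcMeasure = L z := by
  have hLd : DiffContOnCl ℂ L (Metric.ball 0 1) := DifferentiableOn.diffContOnCl fun w hw => by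
    rw [closure_ball 0 one_ne_zero, mem_closedBall_zero_iff] at hw
    exact (hL w hw).differentiableWithinAt
  have hLc : Continuous fun ζ : Circle => L ζ := by
    rw [continuous_iff_continuousAt]
    exact fun ζ => (hL ζ (Circle.norm_coe ζ).le).continuousAt.comp
      continuous_subtype_val.continuousAt
  have hcoe : Continuous fun ζ : Circle => (ζ : ℂ) := continuous_subtype_val
  have hne : ∀ ζ : Circle, (ζ : ℂ) - z ≠ 0 := fun ζ => by
    rw [sub_ne_zero]
    rintro h
    rw [← h, Circle.norm_coe] at hz
    exact lt_irrefl _ hz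
  have hne' : ∀ w : ℂ, ‖w‖ ≤ 1 → 1 - conj z * w ≠ 0 := fun w hw => by
    rw [sub_ne_zero]
    intro h
    have : ‖conj z * w‖ < 1 := by
      rw [norm_mul, RCLike.norm_conj]
      exact (mul_le_of_le_one_right (norm_nonneg _) hw).trans_lt hz
    rw [← h, norm_one] at this
    exact lt_irrefl _ this
  set F : ℂ → ℂ := fun w => (1 + conj z * w) / (1 - conj z * w) * L w with hF
  have hFd : DiffContOnCl ℂ F (Metric.ball 0 1) := DifferentiableOn.diffContOnCl fun w hw => by
    rw [closure_ball 0 one_ne_zero, mem_closedBall_zero_iff] at hw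
    have h1 : DifferentiableAt ℂ (fun w => 1 + conj z * w) w := by fun_prop
    have h2 : DifferentiableAt ℂ (fun w => 1 - conj z * w) w := by fun_prop
    exact ((h1.div h2 (hne' w hw)).mul (hL w hw)).differentiableWithinAt
  have i1 : Continuous fun ζ : Circle => (ζ : ℂ) / ((ζ : ℂ) - z) * L ζ :=
    (hcoe.div (hcoe.sub continuous_const) hne).mul hLc
  have i3 : Continuous fun ζ : Circle => F ζ :=
    ((continuous_const.add (continuous_const.mul hcoe)).div
      (continuous_const.sub (continuous_const.mul hcoe))
      fun ζ => hne' ζ (Circle.norm_coe ζ).le).mul hLc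
  -- Split Re L = (L + conj L)/2. With L the kernel is twice the Cauchy kernel minus 1; with conj L
  -- the product is the conjugate of the boundary values of F, holomorphic with F(0) = L(0). As L(0)
  -- is real, the two contributions of L(0)/2 cancel.
  have e : ∀ ζ : Circle, (((ζ : ℂ) + z) / ((ζ : ℂ) - z)) * ((L ζ).re : ℂ) =
      (ζ : ℂ) / ((ζ : ℂ) - z) * L ζ - (1 / 2) * L ζ + (1 / 2) * conj (F ζ) := by
    intro ζ
    have hc := conj_coe_mul_coe ζ
    have h1 := hne ζ
    have h2 : 1 - z * conj (ζ : ℂ) ≠ 0 := by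
      have := (map_ne_zero (starRingEnd ℂ)).2 (hne' ζ (Circle.norm_coe ζ).le)
      simpa using this
    have h3 : (1 + z * conj (ζ : ℂ)) / (1 - z * conj (ζ : ℂ)) = ((ζ : ℂ) + z) / ((ζ : ℂ) - z) := by
      rw [div_eq_div_iff h2 h1]
      linear_combination (2 * z) * hc
    have h4 : conj (F ζ) = ((ζ : ℂ) + z) / ((ζ : ℂ) - z) * conj (L ζ) := by
      simp only [hF, map_mul, map_div₀, map_add, map_sub, map_one, Complex.conj_conj]
      rw [h3]
    rw [h4, Complex.re_eq_add_conj]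
    field_simp
    ring
  rw [integral_congr_ae (Eventually.of_forall e), integral_add, integral_sub, integral_const_mul,
    integral_const_mul, integral_conj]
  · have a1 : ∫ ζ : Circle, (ζ : ℂ) / ((ζ : ℂ) - z) * L ζ ∂arcMeasure = L z := by
      refine (integral_arcMeasure (F := fun w => w / (w - z) * L w) i1).trans ?_
      have := DiffContOnCl.circleAverage_smul_div (R := 1) (w := z) (by simpa using hLd)
        (by simpa using hz)
      simpa using this
    have a2 : ∫ ζ : Circle, L ζ ∂arcMeasure = L 0 := integral_arcMeasure_of_diffContOnCl hLd
    have a3 : ∫ ζ : Circle, F ζ ∂arcMeasure = L 0 := by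
      refine (integral_arcMeasure_of_diffContOnCl hFd).trans ?_
      simp [hF]
    rw [a1, a2, a3, Complex.conj_eq_iff_im.2 h0]
    ring
  · exact integrable_of_continuous _ i1
  · exact integrable_of_continuous _ (continuous_const.mul hLc)
  · exact integrable_of_continuous _ (i1.sub (continuous_const.mul hLc))
  · exact integrable_of_continuous _ (continuous_const.mul (Complex.continuous_conj.comp i3))

/-- A nonvanishing holomorphic function on a disc has a holomorphic logarithm. -/
lemma exists_holomorphic_log {H : ℂ → ℂ} {r : ℝ} (hr : 0 < r)
    (hH : DifferentiableOn ℂ H (Metric.ball 0 r)) (hne : ∀ z ∈ Metric.ball (0 : ℂ) r, H z ≠ 0)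
    (h0 : H 0 = 1) : ∃ L : ℂ → ℂ, L 0 = 0 ∧ DifferentiableOn ℂ L (Metric.ball 0 r) ∧
      ∀ z ∈ Metric.ball (0 : ℂ) r, Complex.exp (L z) = H z := by
  have hd : DifferentiableOn ℂ (fun z => deriv H z / H z) (Metric.ball 0 r) :=
    (hH.deriv Metric.isOpen_ball).div hH hne
  obtain ⟨L, hL0, hL⟩ := hd.isExactOn_ball.with_val_at 0 0
  refine ⟨L, hL0, fun z hz => (hL z hz).differentiableAt.differentiableWithinAt, fun z hz => ?_⟩
  have hder : ∀ w ∈ Metric.ball (0 : ℂ) r,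
      HasDerivAt (fun w => H w * Complex.exp (-L w)) 0 w := fun w hw => by
    have h1 := (hH.differentiableAt (Metric.isOpen_ball.mem_nhds hw)).hasDerivAt
    have h2 := (hL w hw).neg.cexp
    refine (h1.mul h2).congr_deriv ?_
    field_simp [hne w hw]
    simp
  have hconst := Metric.isOpen_ball.is_const_of_deriv_eq_zero
    (convex_ball (0 : ℂ) r).isPreconnected
    (fun w hw => (hder w hw).differentiableAt.differentiableWithinAt)
    (fun w hw => (hder w hw).deriv) hz (Metric.mem_ball_self hr)
  simp only [h0, hL0, neg_zero, Complex.exp_zero, mul_one] at hconst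
  rw [Complex.exp_neg, mul_inv_eq_one₀ (Complex.exp_ne_zero _)] at hconst
  exact hconst.symm

/-- By compactness H has no zero on some disc slightly larger than the closed unit disc, so the
logarithm is holomorphic across the circle, as the Schwarz formula above requires. -/
lemma ExpDecay.exists_log_szegoLim {α : ℕ → ℂ} {b M : ℝ} (h : ExpDecay α b M) :
    ∃ L : ℂ → ℂ, L 0 = 0 ∧ (∀ w, ‖w‖ ≤ 1 → DifferentiableAt ℂ L w) ∧
      ∀ w, ‖w‖ ≤ 1 → Complex.exp (L w) = szegoLim α w := by
  have hd := h.differentiableOn_szegoLim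
  have hU : IsOpen (Metric.ball 0 b⁻¹ ∩ szegoLim α ⁻¹' {0}ᶜ) :=
    hd.continuousOn.isOpen_inter_preimage Metric.isOpen_ball isOpen_compl_singleton
  have h1 : 1 < b⁻¹ := (one_lt_inv₀ h.pos).2 h.lt_one
  have hsub : Metric.closedBall (0 : ℂ) 1 ⊆ Metric.ball 0 b⁻¹ ∩ szegoLim α ⁻¹' {0}ᶜ :=
    fun z hz => ⟨Metric.closedBall_subset_ball h1 hz,
      h.szegoLim_ne_zero (mem_closedBall_zero_iff.1 hz)⟩
  obtain ⟨δ, hδ, hδU⟩ := (isCompact_closedBall (0 : ℂ) 1).exists_thickening_subset_open hU hsub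
  rw [thickening_closedBall hδ zero_le_one] at hδU
  obtain ⟨L, hL0, hL, he⟩ := exists_holomorphic_log (H := szegoLim α) (r := δ + 1) (by linarith)
    (hd.mono fun z hz => (hδU hz).1) (fun z hz => (hδU hz).2) (szegoLim_zero α)
  have hm : ∀ w : ℂ, ‖w‖ ≤ 1 → w ∈ Metric.ball (0 : ℂ) (δ + 1) := fun w hw =>
    mem_ball_zero_iff.2 (by linarith)
  exact ⟨L, hL0, fun w hw => hL.differentiableAt (Metric.isOpen_ball.mem_nhds (hm w hw)),
    fun w hw => he w (hm w hw)⟩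

/-- The Szegő condition, and the Szegő function, for exponentially decaying Verblunsky
coefficients. -/
theorem szego_of_expDecay {μ : Measure Circle} [IsProbabilityMeasure μ]
    (hμ : NontrivialMeasure μ) {b M N : ℝ} (h : ExpDecay (verblunsky μ) b M)
    (hN : Tendsto (normProd (verblunsky μ)) atTop (𝓝 N)) (hN0 : 0 < N) :
    SzegoCondition μ ∧ ∀ z, ‖z‖ < 1 → szegoD μ z = √N / szegoLim (verblunsky μ) z := by
  obtain ⟨L, hL0, hL, hexp⟩ := h.exists_log_szegoLim
  set H := szegoLim (verblunsky μ)
  have hH0 : ∀ ζ : Circle, ‖H ζ‖ ≠ 0 := fun ζ =>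
    norm_ne_zero_iff.2 (h.szegoLim_ne_zero (Circle.norm_coe ζ).le)
  have hLc : Continuous fun ζ : Circle => L ζ := by
    rw [continuous_iff_continuousAt]
    exact fun ζ => (hL ζ (Circle.norm_coe ζ).le).continuousAt.comp
      continuous_subtype_val.continuousAt
  have hHe : ∀ ζ : Circle, Complex.exp (L ζ) = H ζ := fun ζ => hexp ζ (Circle.norm_coe ζ).le
  have hHc : Continuous fun ζ : Circle => H ζ := by
    simp only [← hHe]; exact Complex.continuous_exp.comp hLc
  have hgc : Continuous fun ζ : Circle => N / ‖H ζ‖ ^ 2 :=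
    continuous_const.div (hHc.norm.pow 2) fun ζ => pow_ne_zero 2 (hH0 ζ)
  have hpos : ∀ ζ : Circle, 0 < N / ‖H ζ‖ ^ 2 := fun ζ =>
    div_pos hN0 (pow_pos ((norm_nonneg _).lt_of_ne' (hH0 ζ)) 2)
  have hw : ∀ᵐ ζ ∂arcMeasure, weight μ ζ = N / ‖H ζ‖ ^ 2 := by
    have h1 : μ.rnDeriv arcMeasure =ᵐ[arcMeasure] fun ζ => ENNReal.ofReal (N / ‖H ζ‖ ^ 2) := by
      conv_lhs => rw [eq_densityMeasure hμ h hN hN0.le hgc]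
      exact Measure.rnDeriv_withDensity _ hgc.measurable.ennreal_ofReal
    filter_upwards [h1] with ζ hζ
    rw [weight, hζ, ENNReal.toReal_ofReal (hpos ζ).le]
  -- A holomorphic function with boundary real part log w and real value at 0; half of it is log D.
  set L₁ : ℂ → ℂ := fun w => (Real.log N : ℂ) - 2 * L w with hL₁
  have hlog : ∀ ζ : Circle, Real.log (N / ‖H ζ‖ ^ 2) = (L₁ ζ).re := fun ζ => by
    rw [Real.log_div hN0.ne' (pow_ne_zero 2 (hH0 ζ)), Real.log_pow, ← hHe, Complex.norm_exp,
      Real.log_exp]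
    simp [hL₁]
  have hL₁c : Continuous fun ζ : Circle => L₁ ζ := continuous_const.sub (continuous_const.mul hLc)
  have hlogw : (fun ζ => Real.log (weight μ ζ)) =ᵐ[arcMeasure] fun ζ => (L₁ ζ).re := by
    filter_upwards [hw] with ζ hζ
    rw [hζ, hlog]
  refine ⟨⟨?_, ?_⟩, fun z hz => ?_⟩
  · filter_upwards [hw] with ζ hζ
    rw [hζ]; exact hpos ζ
  · exact ((integrable_of_continuous arcMeasure hL₁c).re).congr hlogw.symm
  · have h1 : ∫ ζ : Circle, (((ζ : ℂ) + z) / ((ζ : ℂ) - z)) * (Real.log (weight μ ζ) : ℂ)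
        ∂arcMeasure = L₁ z := by
      rw [← integral_schwarz (L := L₁) (fun w hw => (differentiableAt_const _).sub
        ((differentiableAt_const _).mul (hL w hw))) (by simp [hL₁, hL0]) hz]
      refine integral_congr_ae ?_
      filter_upwards [hlogw] with ζ hζ
      rw [hζ]
    rw [szegoD, h1, ← hexp z hz.le, ← Complex.exp_log (x := (√N : ℂ)), ← Complex.exp_sub]
    · congr 1
      rw [← Complex.ofReal_log (Real.sqrt_nonneg _), Real.log_sqrt hN0.le, hL₁]
      push_cast
      ring
    · exact_mod_cast (Real.sqrt_pos.2 hN0).ne'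

/-! ### Continuation of `lim Φₙ*` across the circle `|z| = 1/b` -/

/-- The reflection of `lim Φₙ*` in the unit circle. -/
def szegoRefl (α : ℕ → ℂ) (z : ℂ) : ℂ := conj (szegoLim α (conj z)⁻¹)

/-- The difference between the terms of the series for `lim Φₙ*` and their leading behaviour
outside the unit disc. -/
def resTerm (α : ℕ → ℂ) (b : ℝ) (C : ℂ) (j : ℕ) (z : ℂ) : ℂ :=
  α j * z * (szegoPoly α j).eval z - C * (b : ℂ) ^ j * z ^ (j + 1) * szegoRefl α z

/-- The tail `∑_{j ≥ n}` of the series of the terms `resTerm`. -/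
def resTail (α : ℕ → ℂ) (b : ℝ) (C : ℂ) (n : ℕ) (z : ℂ) : ℂ := ∑' j, resTerm α b C (j + n) z

/-- The expression of `lim Φₙ*` outside the unit disc, with the pole at `1/b` separated. -/
def outerLim (α : ℕ → ℂ) (b : ℝ) (C : ℂ) (z : ℂ) : ℂ :=
  1 - C * z * (1 - b * z)⁻¹ * szegoRefl α z - resTail α b C 0 z

open Classical in
/-- The meromorphic continuation of `lim Φₙ*`. -/
def szegoCont (α : ℕ → ℂ) (b : ℝ) (C : ℂ) (z : ℂ) : ℂ :=
  if ‖z‖ < b⁻¹ then szegoLim α z else outerLim α b C z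

/-- Verblunsky coefficients with `αₙ = C bⁿ + O((bδ)ⁿ)`. -/
structure BLSDecay (α : ℕ → ℂ) (b M : ℝ) (C : ℂ) (δ : ℝ) : Prop extends ExpDecay α b M where
  le : b ≤ δ
  lt : δ < 1
  diff_bound : ∀ n, ‖α n - C * (b : ℂ) ^ n‖ ≤ M * (b * δ) ^ n

section

variable {α : ℕ → ℂ} {b M δ : ℝ} {C : ℂ}

lemma BLSDecay.pos' (h : BLSDecay α b M C δ) : 0 < δ := h.pos.trans_le h.le

lemma BLSDecay.inv_lt (h : BLSDecay α b M C δ) : b⁻¹ < (b * δ)⁻¹ := by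
  have hb := h.pos
  refine (inv_lt_inv₀ hb (mul_pos hb h.pos')).2 ?_
  nlinarith [h.lt]

/-- After reflection there are two errors: replacing αⱼ by C bʲ costs (bδ)ʲ, and replacing Φⱼ* by H
inside the disc costs bʲ · bʲ, which `b ≤ δ` absorbs. -/
lemma BLSDecay.exists_resTerm_bound (h : BLSDecay α b M C δ) : ∃ K : ℝ, 0 < K ∧
    ∀ r j z, 1 ≤ ‖z‖ → ‖z‖ ≤ r → ‖resTerm α b C j z‖ ≤ K * r * (b * δ * r) ^ j := by
  obtain ⟨K₀, c, hK₀, -, hd, -⟩ := h.exists_bounds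
  obtain ⟨K₁, hK₁, hr⟩ := h.exists_rate
  have hb := h.pos
  have hδ := h.pos'
  have hM := h.nonneg
  refine ⟨(M + 1) * K₀ + ‖C‖ * K₁, by positivity, fun r j z hz hzr => ?_⟩
  have hz0 : z ≠ 0 := norm_pos_iff.1 (by linarith)
  have hy : ‖(conj z)⁻¹‖ ≤ 1 := by
    rw [norm_inv, RCLike.norm_conj]; exact inv_le_one_of_one_le₀ hz
  have e : resTerm α b C j z = z ^ (j + 1) * ((α j - C * (b : ℂ) ^ j) *
      conj ((szegoDual α j).eval (conj z)⁻¹) + C * (b : ℂ) ^ j *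
      conj ((szegoDual α j).eval (conj z)⁻¹ - szegoLim α (conj z)⁻¹)) := by
    rw [resTerm, szegoRefl, szegoPoly_reflection α j hz0, map_sub]; ring
  rw [e, norm_mul, norm_pow]
  have h1 : ‖(α j - C * (b : ℂ) ^ j) * conj ((szegoDual α j).eval (conj z)⁻¹)‖ ≤
      (M + 1) * (b * δ) ^ j * K₀ := by
    rw [norm_mul, RCLike.norm_conj]
    refine mul_le_mul ((h.diff_bound j).trans ?_) (hd j _ hy).1 (norm_nonneg _) (by positivity)
    gcongr
    linarith
  have h2 : ‖C * (b : ℂ) ^ j * conj ((szegoDual α j).eval (conj z)⁻¹ - szegoLim α (conj z)⁻¹)‖ ≤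
      ‖C‖ * (K₁ * (b * δ) ^ j) := by
    rw [norm_mul, norm_mul, RCLike.norm_conj, norm_pow, Complex.norm_real,
      Real.norm_of_nonneg hb.le, mul_assoc]
    refine mul_le_mul_of_nonneg_left ?_ (norm_nonneg _)
    calc b ^ j * ‖(szegoDual α j).eval (conj z)⁻¹ - szegoLim α (conj z)⁻¹‖
        ≤ b ^ j * (K₁ * b ^ j) := by gcongr; exact hr j _ hy
      _ = K₁ * (b * b) ^ j := by rw [mul_pow]; ring
      _ ≤ K₁ * (b * δ) ^ j := by gcongr; exact h.le
  calc ‖z‖ ^ (j + 1) * _ ≤ r ^ (j + 1) * ((M + 1) * (b * δ) ^ j * K₀ +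
          ‖C‖ * (K₁ * (b * δ) ^ j)) := by
        have hr0 : 0 ≤ r := by linarith
        gcongr
        exact (norm_add_le _ _).trans (add_le_add h1 h2)
    _ = _ := by rw [mul_pow (b * δ) r]; ring

lemma BLSDecay.ratio_lt_one (h : BLSDecay α b M C δ) {r : ℝ} (hr : r < (b * δ)⁻¹) :
    b * δ * r < 1 :=
  have hp := mul_pos h.pos h.pos'
  (mul_lt_mul_of_pos_left hr hp).trans_eq (mul_inv_cancel₀ hp.ne')

lemma BLSDecay.summable_resTerm (h : BLSDecay α b M C δ) {z : ℂ} (h1 : 1 ≤ ‖z‖)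
    (h2 : ‖z‖ < (b * δ)⁻¹) : Summable fun j => resTerm α b C j z := by
  obtain ⟨K, hK, hb⟩ := h.exists_resTerm_bound
  have hb0 := h.pos
  have hδ := h.pos'
  exact Summable.of_norm_bounded ((summable_geometric_of_lt_one (by positivity)
    (h.ratio_lt_one h2)).mul_left _) fun j => hb ‖z‖ j z h1 le_rfl

lemma BLSDecay.exists_resTail_bound (h : BLSDecay α b M C δ) : ∃ K : ℝ, 0 < K ∧
    ∀ n z, 1 ≤ ‖z‖ → ‖z‖ < (b * δ)⁻¹ →
      ‖resTail α b C n z‖ ≤ K * ‖z‖ / (1 - b * δ * ‖z‖) * (b * δ * ‖z‖) ^ n := by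
  obtain ⟨K, hK, hb⟩ := h.exists_resTerm_bound
  have hb0 := h.pos
  have hδ := h.pos'
  refine ⟨K, hK, fun n z h1 h2 => ?_⟩
  have hs := (hasSum_geometric_of_lt_one (by positivity) (h.ratio_lt_one h2)).mul_left
    (K * ‖z‖ * (b * δ * ‖z‖) ^ n)
  refine (tsum_of_norm_bounded hs fun j => ?_).trans_eq (by ring)
  refine (hb ‖z‖ (j + n) z h1 le_rfl).trans_eq ?_
  rw [pow_add]; ring

lemma ExpDecay.differentiableAt_szegoRefl (h : ExpDecay α b M) {z : ℂ} (hz : b < ‖z‖) :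
    DifferentiableAt ℂ (szegoRefl α) z := by
  have hz0 : z ≠ 0 := norm_pos_iff.1 (h.pos.trans hz)
  have e : szegoRefl α = (conj ∘ szegoLim α ∘ conj) ∘ fun w => w⁻¹ := by
    ext w; simp [szegoRefl]
  rw [e]
  refine DifferentiableAt.comp z ?_ (differentiableAt_inv hz0)
  rw [differentiableAt_conj_conj_iff]
  refine h.differentiableOn_szegoLim.differentiableAt (Metric.isOpen_ball.mem_nhds ?_)
  rw [mem_ball_zero_iff, RCLike.norm_conj, norm_inv]
  exact (inv_lt_inv₀ (h.pos.trans hz) h.pos).2 hz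

lemma isOpen_annulus (r s : ℝ) : IsOpen {z : ℂ | r < ‖z‖ ∧ ‖z‖ < s} :=
  (isOpen_lt continuous_const continuous_norm).inter (isOpen_lt continuous_norm continuous_const)

lemma BLSDecay.differentiableAt_resTail (h : BLSDecay α b M C δ) (n : ℕ) {z : ℂ} (h1 : 1 < ‖z‖)
    (h2 : ‖z‖ < (b * δ)⁻¹) : DifferentiableAt ℂ (resTail α b C n) z := by
  obtain ⟨K, hK, hb⟩ := h.exists_resTerm_bound
  have hb0 := h.pos
  have hδ := h.pos'
  obtain ⟨r, hzr, hr⟩ := exists_between h2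
  have hr0 : 0 < r := by linarith
  have hd : DifferentiableOn ℂ (resTail α b C n) {z : ℂ | 1 < ‖z‖ ∧ ‖z‖ < r} := by
    refine Complex.differentiableOn_tsum_of_summable_norm
      (u := fun j => K * r * (b * δ * r) ^ (j + n)) ?_ (fun j w hw => ?_) (isOpen_annulus 1 r)
      (fun j w hw => hb r (j + n) w hw.1.le hw.2.le)
    · simp only [pow_add]
      exact ((summable_geometric_of_lt_one (by positivity)
        (h.ratio_lt_one hr)).mul_right _).mul_left _
    · have hR := h.differentiableAt_szegoRefl (h.lt_one.trans hw.1)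
      refine DifferentiableAt.differentiableWithinAt ?_
      exact ((differentiableAt_id.const_mul _).mul (Polynomial.differentiableAt _)).sub
        (((differentiableAt_id.pow _).const_mul _).mul hR)
  exact hd.differentiableAt ((isOpen_annulus 1 r).mem_nhds ⟨h1, hzr⟩)

lemma one_sub_mul_ne_zero {b : ℝ} {z : ℂ} (hz : z ≠ (b : ℂ)⁻¹) : 1 - (b : ℂ) * z ≠ 0 := by
  rw [sub_ne_zero]
  exact fun he => hz (eq_inv_of_mul_eq_one_right he.symm)

/-- Outside the unit disc, `Φₙ*` is the continuation of its limit up to an explicit correction. -/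
lemma BLSDecay.szegoDual_eq (h : BLSDecay α b M C δ) (n : ℕ) {z : ℂ} (h1 : 1 ≤ ‖z‖)
    (h2 : ‖z‖ < (b * δ)⁻¹) (hz : z ≠ (b : ℂ)⁻¹) :
    (szegoDual α n).eval z = outerLim α b C z +
      C * z * (b * z) ^ n * (1 - b * z)⁻¹ * szegoRefl α z + resTail α b C n z := by
  have hne := one_sub_mul_ne_zero hz
  have hsum := (h.summable_resTerm h1 h2).sum_add_tsum_nat_add n
  have e0 : resTail α b C 0 z = ∑' j, resTerm α b C j z := rfl
  -- The main parts form a finite geometric sum in bz, valid also for |bz| ≥ 1; its denominator is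
  -- the source of the pole at 1/b.
  have hg : ∑ j ∈ Finset.range n, C * (b : ℂ) ^ j * z ^ (j + 1) * szegoRefl α z =
      C * z * szegoRefl α z * ((1 - (b * z) ^ n) * (1 - b * z)⁻¹) := by
    rw [← div_eq_mul_inv, ← neg_div_neg_eq, neg_sub, neg_sub, ← geom_sum_eq (by
      intro he; exact hne (by rw [he, sub_self])), Finset.mul_sum]
    refine Finset.sum_congr rfl fun j _ => ?_
    rw [mul_pow]; ring
  have hs : ∑ j ∈ Finset.range n, α j * z * (szegoPoly α j).eval z =
      ∑ j ∈ Finset.range n, resTerm α b C j z +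
      ∑ j ∈ Finset.range n, C * (b : ℂ) ^ j * z ^ (j + 1) * szegoRefl α z := by
    rw [← Finset.sum_add_distrib]
    exact Finset.sum_congr rfl fun j _ => by rw [resTerm]; ring
  rw [szegoDual_eq_sub_sum, hs, hg, outerLim, e0, ← hsum, resTail]
  ring

/-- Let n → ∞ in `BLSDecay.szegoDual_eq`: here |bz| < 1, so both corrections vanish. The two
formulas thus agree on an annulus and glue to one analytic function. -/
lemma BLSDecay.szegoLim_eq_outerLim (h : BLSDecay α b M C δ) {z : ℂ} (h1 : 1 ≤ ‖z‖)
    (h2 : ‖z‖ < b⁻¹) : szegoLim α z = outerLim α b C z := by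
  have h3 : ‖z‖ < (b * δ)⁻¹ := h2.trans h.inv_lt
  have hz : z ≠ (b : ℂ)⁻¹ := by
    rintro rfl
    rw [norm_inv, Complex.norm_real, Real.norm_of_nonneg h.pos.le] at h2
    exact lt_irrefl _ h2
  have hbz : ‖(b : ℂ) * z‖ < 1 := by
    rw [norm_mul, Complex.norm_real, Real.norm_of_nonneg h.pos.le]
    exact (mul_lt_mul_of_pos_left h2 h.pos).trans_eq (mul_inv_cancel₀ h.pos.ne')
  have t1 := (tendsto_pow_atTop_nhds_zero_of_norm_lt_one hbz)
  have t2 : Tendsto (fun n => resTail α b C n z) atTop (𝓝 0) :=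
    tendsto_sum_nat_add fun j => resTerm α b C j z
  have t3 : Tendsto (fun n => outerLim α b C z +
      C * z * (b * z) ^ n * (1 - b * z)⁻¹ * szegoRefl α z + resTail α b C n z) atTop
      (𝓝 (outerLim α b C z + C * z * 0 * (1 - b * z)⁻¹ * szegoRefl α z + 0)) :=
    (((t1.const_mul _).mul_const _).mul_const _ |>.const_add _).add t2
  simp only [← h.szegoDual_eq _ h1 h3 hz] at t3
  simpa using tendsto_nhds_unique (h.tendsto_szegoDual h2) t3

lemma BLSDecay.szegoCont_eq_outerLim (h : BLSDecay α b M C δ) {z : ℂ} (h1 : 1 ≤ ‖z‖) :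
    szegoCont α b C z = outerLim α b C z := by
  rw [szegoCont]
  split_ifs with h2
  · exact h.szegoLim_eq_outerLim h1 h2
  · rfl

lemma szegoCont_eq_szegoLim {z : ℂ} (hz : ‖z‖ < b⁻¹) : szegoCont α b C z = szegoLim α z :=
  if_pos hz

lemma BLSDecay.differentiableAt_outerLim (h : BLSDecay α b M C δ) {z : ℂ} (h1 : 1 < ‖z‖)
    (h2 : ‖z‖ < (b * δ)⁻¹) (hz : z ≠ (b : ℂ)⁻¹) : DifferentiableAt ℂ (outerLim α b C) z := by
  have hR := h.differentiableAt_szegoRefl (h.lt_one.trans h1)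
  have hi : DifferentiableAt ℂ (fun w : ℂ => (1 - b * w)⁻¹) z :=
    DifferentiableAt.inv (by fun_prop) (one_sub_mul_ne_zero hz)
  exact (((((differentiableAt_id.const_mul _).mul hi).mul hR).const_sub _)).sub
    (h.differentiableAt_resTail 0 h1 h2)

lemma BLSDecay.analyticAt_szegoCont (h : BLSDecay α b M C δ) {z : ℂ}
    (hz : ‖z‖ < (b * δ)⁻¹) (hne : z ≠ (b : ℂ)⁻¹) : AnalyticAt ℂ (szegoCont α b C) z := by
  rw [Complex.analyticAt_iff_eventually_differentiableAt]
  by_cases h1 : ‖z‖ < b⁻¹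
  · have hU : Metric.ball (0 : ℂ) b⁻¹ ∈ 𝓝 z :=
      Metric.isOpen_ball.mem_nhds (mem_ball_zero_iff.2 h1)
    filter_upwards [eventually_mem_nhds_iff.2 hU] with w hw
    refine (h.differentiableOn_szegoLim.differentiableAt hw).congr_of_eventuallyEq ?_
    filter_upwards [hw] with v hv using szegoCont_eq_szegoLim (mem_ball_zero_iff.1 hv)
  · have h1' : 1 < ‖z‖ := ((one_lt_inv₀ h.pos).2 h.lt_one).trans_le (not_lt.1 h1)
    have hU : {w : ℂ | 1 < ‖w‖ ∧ ‖w‖ < (b * δ)⁻¹} ∈ 𝓝 z :=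
      (isOpen_annulus _ _).mem_nhds ⟨h1', hz⟩
    filter_upwards [eventually_mem_nhds_iff.2 hU, isOpen_ne.mem_nhds hne] with w hw hwne
    have hw' := mem_of_mem_nhds hw
    refine (h.differentiableAt_outerLim hw'.1 hw'.2 hwne).congr_of_eventuallyEq ?_
    filter_upwards [hw] with v hv using h.szegoCont_eq_outerLim hv.1.le

/-- The regular factor of the continuation at the pole `1/b`. -/
def poleFactor (α : ℕ → ℂ) (b : ℝ) (C : ℂ) (z : ℂ) : ℂ :=
  (z - (b : ℂ)⁻¹) * (1 - resTail α b C 0 z) + C * z * (b : ℂ)⁻¹ * szegoRefl α z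

lemma norm_ofReal_inv (hb : 0 < b) : ‖(b : ℂ)⁻¹‖ = b⁻¹ := by
  rw [norm_inv, Complex.norm_real, Real.norm_of_nonneg hb.le]

lemma BLSDecay.annulus_mem_nhds (h : BLSDecay α b M C δ) :
    {w : ℂ | 1 < ‖w‖ ∧ ‖w‖ < (b * δ)⁻¹} ∈ 𝓝 (b : ℂ)⁻¹ := by
  refine (isOpen_annulus _ _).mem_nhds ⟨?_, ?_⟩
  · rw [norm_ofReal_inv h.pos]; exact (one_lt_inv₀ h.pos).2 h.lt_one
  · rw [norm_ofReal_inv h.pos]; exact h.inv_lt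

lemma BLSDecay.analyticAt_poleFactor (h : BLSDecay α b M C δ) :
    AnalyticAt ℂ (poleFactor α b C) (b : ℂ)⁻¹ := by
  rw [Complex.analyticAt_iff_eventually_differentiableAt]
  filter_upwards [h.annulus_mem_nhds] with w hw
  have hR := h.differentiableAt_szegoRefl (h.lt_one.trans hw.1)
  exact ((differentiableAt_id.sub_const _).mul
    ((h.differentiableAt_resTail 0 hw.1 hw.2).const_sub _)).add
    (((differentiableAt_id.const_mul _).mul_const _).mul hR)

/-- The reflection of 1/b is b, inside the disc, where H has no zero. So the pole is genuine exactly
when C ≠ 0. -/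
lemma poleFactor_inv (α : ℕ → ℂ) (b : ℝ) (C : ℂ) : poleFactor α b C (b : ℂ)⁻¹ =
    C * (b : ℂ)⁻¹ * (b : ℂ)⁻¹ * conj (szegoLim α b) := by
  simp [poleFactor, szegoRefl]

lemma BLSDecay.szegoCont_eq_poleFactor (h : BLSDecay α b M C δ) :
    ∀ᶠ z in 𝓝[≠] (b : ℂ)⁻¹, szegoCont α b C z = (z - (b : ℂ)⁻¹)⁻¹ * poleFactor α b C z := by
  filter_upwards [nhdsWithin_le_nhds h.annulus_mem_nhds, self_mem_nhdsWithin] with z hz hne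
  rw [Set.mem_compl_singleton_iff] at hne
  have hb : (b : ℂ) ≠ 0 := by exact_mod_cast h.pos.ne'
  have h1 := one_sub_mul_ne_zero hne
  have h2 : (1 - (b : ℂ) * z)⁻¹ = -((z - (b : ℂ)⁻¹)⁻¹ * (b : ℂ)⁻¹) := by
    rw [← mul_inv, ← inv_neg]
    congr 1
    field_simp
    ring
  have h3 : (z - (b : ℂ)⁻¹)⁻¹ * (z - (b : ℂ)⁻¹) = 1 := inv_mul_cancel₀ (sub_ne_zero.2 hne)
  rw [h.szegoCont_eq_outerLim hz.1.le, outerLim, poleFactor, h2]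
  linear_combination (resTail α b C 0 z - 1) * h3

lemma BLSDecay.meromorphicAt_szegoCont (h : BLSDecay α b M C δ) :
    MeromorphicAt (szegoCont α b C) (b : ℂ)⁻¹ := by
  have h1 : MeromorphicAt (fun z : ℂ => (z - (b : ℂ)⁻¹)⁻¹ * poleFactor α b C z) (b : ℂ)⁻¹ :=
    ((MeromorphicAt.id _).sub (MeromorphicAt.const _ _)).inv.mul
      h.analyticAt_poleFactor.meromorphicAt
  exact h1.congr (h.szegoCont_eq_poleFactor.mono fun z hz => hz.symm)

lemma BLSDecay.tendsto_residue (h : BLSDecay α b M C δ) :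
    Tendsto (fun z : ℂ => (z⁻¹ - (b : ℂ)) * szegoCont α b C z) (𝓝[≠] (b : ℂ)⁻¹)
      (𝓝 (-C * conj (szegoLim α b))) := by
  have hb : (b : ℂ) ≠ 0 := by exact_mod_cast h.pos.ne'
  have h1 : Tendsto (fun z : ℂ => -(b : ℂ) * z⁻¹ * poleFactor α b C z) (𝓝 (b : ℂ)⁻¹)
      (𝓝 (-(b : ℂ) * (b : ℂ)⁻¹⁻¹ * poleFactor α b C (b : ℂ)⁻¹)) :=
    ((tendsto_inv₀ (inv_ne_zero hb)).const_mul _).mul h.analyticAt_poleFactor.continuousAt.tendsto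
  have h2 : -(b : ℂ) * (b : ℂ)⁻¹⁻¹ * poleFactor α b C (b : ℂ)⁻¹ = -C * conj (szegoLim α b) := by
    rw [poleFactor_inv]; field_simp
  rw [h2] at h1
  refine (h1.mono_left nhdsWithin_le_nhds).congr' ?_
  filter_upwards [h.szegoCont_eq_poleFactor, self_mem_nhdsWithin,
    nhdsWithin_le_nhds (isOpen_ne.mem_nhds (inv_ne_zero hb))] with z hz hne hz0
  have h3 : z - (b : ℂ)⁻¹ ≠ 0 := sub_ne_zero.2 hne
  have h4 : z⁻¹ - (b : ℂ) = -(b : ℂ) * z⁻¹ * (z - (b : ℂ)⁻¹) := by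
    field_simp [show z ≠ 0 from hz0]
    ring
  rw [hz, h4, mul_assoc _ (z - _), mul_inv_cancel_left₀ h3]

lemma BLSDecay.meromorphicOrderAt_szegoCont (h : BLSDecay α b M C δ) (hC : C ≠ 0) :
    meromorphicOrderAt (szegoCont α b C) (b : ℂ)⁻¹ = ((-1 : ℤ) : WithTop ℤ) := by
  rw [meromorphicOrderAt_eq_int_iff h.meromorphicAt_szegoCont]
  refine ⟨poleFactor α b C, h.analyticAt_poleFactor, ?_, ?_⟩
  · have hb : (b : ℂ) ≠ 0 := by exact_mod_cast h.pos.ne'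
    rw [poleFactor_inv]
    refine mul_ne_zero (mul_ne_zero (mul_ne_zero hC (inv_ne_zero hb)) (inv_ne_zero hb)) ?_
    rw [_root_.map_ne_zero]
    refine h.szegoLim_ne_zero ?_
    rw [Complex.norm_real, Real.norm_of_nonneg h.pos.le]
    exact h.lt_one.le
  · filter_upwards [h.szegoCont_eq_poleFactor] with z hz
    rw [hz, zpow_neg_one, smul_eq_mul]

/-! ### Asymptotics of `Φₙ` inside the disc -/

/-- The error term in the asymptotics of `Φₙ`. -/
def polyError (α : ℕ → ℂ) (b : ℝ) (C : ℂ) (n : ℕ) (z : ℂ) : ℂ :=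
  z ^ n * conj (resTail α b C n (1 / conj z))

lemma norm_one_div_conj (z : ℂ) : ‖1 / conj z‖ = ‖z‖⁻¹ := by
  rw [norm_div, norm_one, RCLike.norm_conj, one_div]

/-- This is `BLSDecay.szegoDual_eq` at 1/z̄, conjugated and multiplied by zⁿ. The factor zⁿ turns
(b/z)ⁿ into bⁿ, and the double reflection returns H(z) in the second term. -/
lemma BLSDecay.szegoPoly_eq (h : BLSDecay α b M C δ) (n : ℕ) {z : ℂ} (h1 : b * δ < ‖z‖)
    (h2 : ‖z‖ ≤ 1) (hz : z ≠ b) :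
    (szegoPoly α n).eval z = conj (szegoCont α b C (1 / conj z)) * z ^ n +
      conj C * (z - b)⁻¹ * szegoCont α b C z * (b : ℂ) ^ n + polyError α b C n z := by
  have hp : 0 < ‖z‖ := (mul_pos h.pos h.pos').trans h1
  have hz0 : z ≠ 0 := norm_pos_iff.1 hp
  have hy1 : 1 ≤ ‖1 / conj z‖ := by
    rw [norm_one_div_conj]; exact (one_le_inv₀ hp).2 h2
  have hy2 : ‖1 / conj z‖ < (b * δ)⁻¹ := by
    rw [norm_one_div_conj]; exact (inv_lt_inv₀ hp (mul_pos h.pos h.pos')).2 h1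
  have hyne : 1 / conj z ≠ (b : ℂ)⁻¹ := by
    rw [one_div, Ne, inv_inj]
    intro he
    apply hz
    rw [← Complex.conj_conj z, he, Complex.conj_ofReal]
  have hzb : ‖z‖ < b⁻¹ := h2.trans_lt ((one_lt_inv₀ h.pos).2 h.lt_one)
  rw [szegoPoly_reflection α n hz0, ← one_div, h.szegoDual_eq n hy1 hy2 hyne,
    h.szegoCont_eq_outerLim hy1, szegoCont_eq_szegoLim hzb, polyError]
  have hsub : z - b ≠ 0 := sub_ne_zero.2 hz
  simp only [szegoRefl, map_add, map_mul, map_pow, map_inv₀, map_sub, map_one, Complex.conj_conj,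
    Complex.conj_ofReal, one_div, inv_inv]
  have e1 : (1 - (b : ℂ) * z⁻¹)⁻¹ = z * (z - b)⁻¹ := by
    rw [← inv_inj, inv_inv, mul_inv, inv_inv]
    field_simp
  have e2 : z ^ n * ((b : ℂ) * z⁻¹) ^ n = (b : ℂ) ^ n := by
    rw [← mul_pow]; congr 1; field_simp
  have e3 : z⁻¹ * z = 1 := inv_mul_cancel₀ hz0
  rw [e1]
  linear_combination (conj C * z⁻¹ * z * (z - b)⁻¹ * szegoLim α z) * e2 +
    (conj C * (z - b)⁻¹ * szegoLim α z * (b : ℂ) ^ n) * e3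

/-- The factor |z|ⁿ cancels the |z|⁻ⁿ in the tail bound. The gap between δ and Δ keeps the geometric
denominator 1 - bδ/|z| uniformly positive. -/
lemma BLSDecay.exists_polyError_bound (h : BLSDecay α b M C δ) {Δ : ℝ} (hΔ : δ < Δ) :
    ∃ K : ℝ, 0 < K ∧ ∀ n z, b * Δ < ‖z‖ → ‖z‖ ≤ 1 → ‖polyError α b C n z‖ ≤ K * (b * δ) ^ n := by
  obtain ⟨K, hK, hb⟩ := h.exists_resTail_bound
  have hb0 := h.pos
  have hδ := h.pos'
  have hΔ0 := hδ.trans hΔ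
  have hq : δ / Δ < 1 := (div_lt_one hΔ0).2 hΔ
  have hq' : 0 < 1 - δ / Δ := sub_pos.2 hq
  refine ⟨K * (b * Δ)⁻¹ / (1 - δ / Δ), by positivity, fun n z h1 h2 => ?_⟩
  have hp : 0 < ‖z‖ := (mul_pos hb0 hΔ0).trans h1
  have hδz : b * δ < ‖z‖ := (mul_lt_mul_of_pos_left hΔ hb0).trans h1
  have hy := hb n (1 / conj z) (by rw [norm_one_div_conj]; exact (one_le_inv₀ hp).2 h2)
    (by rw [norm_one_div_conj]; exact (inv_lt_inv₀ hp (mul_pos hb0 hδ)).2 hδz)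
  rw [norm_one_div_conj] at hy
  have hinv : ‖z‖⁻¹ ≤ (b * Δ)⁻¹ := (inv_le_inv₀ hp (mul_pos hb0 hΔ0)).2 h1.le
  have hden : 1 - δ / Δ ≤ 1 - b * δ * ‖z‖⁻¹ := by
    have : b * δ * ‖z‖⁻¹ ≤ b * δ * (b * Δ)⁻¹ := by gcongr
    have e : b * δ * (b * Δ)⁻¹ = δ / Δ := by field_simp
    linarith
  rw [polyError, norm_mul, norm_pow, RCLike.norm_conj]
  calc ‖z‖ ^ n * ‖resTail α b C n (1 / conj z)‖
      ≤ ‖z‖ ^ n * (K * ‖z‖⁻¹ / (1 - b * δ * ‖z‖⁻¹) * (b * δ * ‖z‖⁻¹) ^ n) := by gcongr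
    _ = K * ‖z‖⁻¹ / (1 - b * δ * ‖z‖⁻¹) * ((b * δ) ^ n * (‖z‖ * ‖z‖⁻¹) ^ n) := by
        rw [mul_pow (b * δ), mul_pow ‖z‖]; ring
    _ = K * ‖z‖⁻¹ / (1 - b * δ * ‖z‖⁻¹) * (b * δ) ^ n := by
        rw [mul_inv_cancel₀ hp.ne', one_pow, mul_one]
    _ ≤ K * (b * Δ)⁻¹ / (1 - δ / Δ) * (b * δ) ^ n := by gcongr

/-- The tail has no pole at 1/b. Hence the leading terms, being a polynomial minus a continuous
error, have a limit at b. -/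
lemma BLSDecay.continuousAt_polyError (h : BLSDecay α b M C δ) (n : ℕ) :
    ContinuousAt (polyError α b C n) b := by
  have hb : (b : ℂ) ≠ 0 := by exact_mod_cast h.pos.ne'
  have hv : 1 / conj (b : ℂ) = (b : ℂ)⁻¹ := by simp
  have h1 : ContinuousAt (resTail α b C n) (1 / conj (b : ℂ)) := by
    have := mem_of_mem_nhds h.annulus_mem_nhds
    rw [hv]
    exact (h.differentiableAt_resTail n this.1 this.2).continuousAt
  have h2 : ContinuousAt (fun z : ℂ => 1 / conj z) b :=
    continuousAt_const.div Complex.continuous_conj.continuousAt (by simpa using hb)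
  exact (continuousAt_id.pow n).mul
    (Complex.continuous_conj.continuousAt.comp
      (ContinuousAt.comp (f := fun z : ℂ => 1 / conj z) h1 h2))

end

end

end OPUC

/-! ### From the BLS condition to the orthonormal polynomials -/

namespace OPUC

/-- Enlarging Δ to δ = max Δ b weakens the hypothesis but lets every b²ⁿ error be absorbed in (bδ)ⁿ.
The O-bound holds for all n, not only eventually, because (bΔ)ⁿ never vanishes. -/
lemma BLSCondition.exists_decay {α : ℕ → ℂ} {b : ℝ} {C : ℂ} (h : BLSCondition α b C)
    (hb0 : 0 < b) (hb1 : b < 1) (hα : ∀ n, ‖α n‖ < 1) : ∃ M δ : ℝ, BLSDecay α b M C δ := by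
  obtain ⟨Δ, hΔ0, hΔ1, hO⟩ := h
  obtain ⟨M, hM, hbd⟩ := Asymptotics.bound_of_isBigO_nat_atTop hO
  have hδ : ∀ n, ‖α n - C * (b : ℂ) ^ n‖ ≤ M * (b * max Δ b) ^ n := fun n => by
    refine (hbd (x := n) (by positivity)).trans ?_
    rw [Real.norm_of_nonneg (by positivity)]
    gcongr
    exact le_max_left _ _
  have hlt : max Δ b < 1 := max_lt hΔ1 hb1
  refine ⟨M + ‖C‖, max Δ b, ⟨hb0, hb1, hα, fun n => ?_⟩, le_max_right _ _, hlt,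
    fun n => (hδ n).trans ?_⟩
  · have h1 : ‖α n‖ ≤ ‖α n - C * (b : ℂ) ^ n‖ + ‖C * (b : ℂ) ^ n‖ := by
      simpa using norm_add_le (α n - C * (b : ℂ) ^ n) (C * (b : ℂ) ^ n)
    have h2 : ‖C * (b : ℂ) ^ n‖ = ‖C‖ * b ^ n := by
      rw [norm_mul, norm_pow, Complex.norm_real, Real.norm_of_nonneg hb0.le]
    have h3 : M * (b * max Δ b) ^ n ≤ M * b ^ n := by
      gcongr
      exact mul_le_of_le_one_right hb0.le hlt.le
    linarith [hδ n]
  · gcongr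
    linarith [norm_nonneg C]

/-- The difference between `φₙ` and its leading term. -/
noncomputable def opError (α : ℕ → ℂ) (b : ℝ) (C : ℂ) (N : ℝ) (n : ℕ) (z : ℂ) : ℂ :=
  (((√(normProd α n))⁻¹ - (√N)⁻¹ : ℝ) : ℂ) * (szegoPoly α n).eval z +
    (((√N)⁻¹ : ℝ) : ℂ) * polyError α b C n z

lemma orthonormalOP_eval {μ : Measure Circle} [IsProbabilityMeasure μ]
    (hμ : NontrivialMeasure μ) {b M δ : ℝ} {C : ℂ} (h : BLSDecay (verblunsky μ) b M C δ) (N : ℝ)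
    (n : ℕ) {z : ℂ} (h1 : b * δ < ‖z‖) (h2 : ‖z‖ ≤ 1) (hz : z ≠ b) :
    (orthonormalOP μ n).eval z =
      leadingTerm (fun w => (((√N)⁻¹ : ℝ) : ℂ) * szegoCont (verblunsky μ) b C w) b C n z +
        opError (verblunsky μ) b C N n z := by
  have e := h.szegoPoly_eq n h1 h2 hz
  rw [orthonormalOP, eval_mul, eval_C, pnorm_monicOP hμ, monicOP_eq_szegoPoly hμ, leadingTerm,
    opError]
  simp only [map_mul, Complex.conj_ofReal]
  push_cast
  linear_combination (√N : ℂ)⁻¹ * e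

end OPUC

theorem theorem9p1 (μ : Measure Circle) [IsProbabilityMeasure μ]
    (hμ : OPUC.NontrivialMeasure μ) (b : ℝ) (hb0 : 0 < b) (hb1 : b < 1) (C : ℂ)
    (hBLS : OPUC.BLSCondition (OPUC.verblunsky μ) b C) :
    -- the Szegő function is well defined
    OPUC.SzegoCondition μ ∧
    ∃ (K Δ₁ Δ₂ : ℝ) (Dinv : ℂ → ℂ), 0 < Δ₁ ∧ Δ₁ < Δ₂ ∧ Δ₂ < 1 ∧
      -- `Dinv` is a meromorphic continuation of `D⁻¹` to `|z| < (bΔ₂)⁻¹`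
      (∀ z : ℂ, ‖z‖ < 1 → Dinv z = (OPUC.szegoD μ z)⁻¹) ∧
      MeromorphicOn Dinv (Metric.ball 0 (b * Δ₂)⁻¹) ∧
      -- with no singularity except at `1/b`
      AnalyticOnNhd ℂ Dinv (Metric.ball 0 (b * Δ₂)⁻¹ \ {(b : ℂ)⁻¹}) ∧
      -- where it has a simple pole if `C ≠ 0`, of the following strength
      (C ≠ 0 → meromorphicOrderAt Dinv (b : ℂ)⁻¹ = ((-1 : ℤ) : WithTop ℤ)) ∧
      Tendsto (fun z : ℂ => -((z⁻¹ - (b : ℂ)) * Dinv z) * conj (OPUC.szegoD μ (b : ℂ)))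
        (𝓝[≠] (b : ℂ)⁻¹) (𝓝 C) ∧
      -- the estimate on the annulus, for `z ≠ b`
      (∀ (n : ℕ) (z : ℂ), b * Δ₂ < ‖z‖ → ‖z‖ < b / Δ₂ → z ≠ (b : ℂ) →
        ‖(OPUC.orthonormalOP μ n).eval z - conj (Dinv (1 / conj z)) * z ^ n
            - conj C * (z - (b : ℂ))⁻¹ * Dinv z * (b : ℂ) ^ n‖ ≤ K * (b * Δ₁) ^ n) ∧
      -- and at `z = b`, where the two poles cancel
      (∀ n : ℕ, ∃ L : ℂ,
        Tendsto (OPUC.leadingTerm Dinv b C n) (𝓝[≠] (b : ℂ)) (𝓝 L) ∧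
        ‖(OPUC.orthonormalOP μ n).eval (b : ℂ) - L‖ ≤ K * (b * Δ₁) ^ n) := by
  obtain ⟨M, δ, h⟩ := hBLS.exists_decay hb0 hb1 (OPUC.norm_verblunsky_lt_one hμ)
  set α := OPUC.verblunsky μ with hα
  obtain ⟨N, K₂, c, hc, hcN, hK₂, -, hNlim, hNrate⟩ := h.exists_normProd_lim
  have hN : 0 < N := hc.trans_le hcN
  obtain ⟨hSz, hD⟩ := OPUC.szego_of_expDecay hμ h.toExpDecay hNlim hN
  rw [← hα] at hD
  obtain ⟨Δ₂, hΔ, hΔ1⟩ := exists_between h.lt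
  have hδ := h.pos'
  have hΔ0 : 0 < Δ₂ := hδ.trans hΔ
  obtain ⟨K₃, hK₃, hErr⟩ := h.exists_polyError_bound hΔ
  obtain ⟨K₀, c₀, hK₀, -, hA, -⟩ := h.exists_bounds
  have hsN : 0 < (√N)⁻¹ := inv_pos.2 (Real.sqrt_pos.2 hN)
  have hsC : (((√N)⁻¹ : ℝ) : ℂ) ≠ 0 := by exact_mod_cast hsN.ne'
  have hbn : ‖(b : ℂ)‖ = b := by rw [Complex.norm_real, Real.norm_of_nonneg hb0.le]
  have hbΔ : b * Δ₂ < b := mul_lt_of_lt_one_right hb0 hΔ1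
  have hδΔ : b * δ < b * Δ₂ := mul_lt_mul_of_pos_left hΔ hb0
  have hball : (b * Δ₂)⁻¹ < (b * δ)⁻¹ :=
    (inv_lt_inv₀ (mul_pos hb0 hΔ0) (mul_pos hb0 hδ)).2 hδΔ
  have hop : ∀ n z, b * Δ₂ < ‖z‖ → ‖z‖ ≤ 1 →
      ‖OPUC.opError α b C N n z‖ ≤ (K₂ * K₀ + (√N)⁻¹ * K₃) * (b * δ) ^ n := by
    intro n z h1 h2
    refine (norm_add_le _ _).trans ?_
    rw [norm_mul, norm_mul, Complex.norm_real, Complex.norm_real, Real.norm_eq_abs,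
      Real.norm_of_nonneg hsN.le]
    -- The normalisation error is b²ⁿ, so `b ≤ δ` puts it at the same rate as the tail.
    have e1 : (b ^ 2) ^ n ≤ (b * δ) ^ n := by
      rw [sq]; gcongr; exact h.le
    calc _ ≤ K₂ * (b * δ) ^ n * K₀ + (√N)⁻¹ * (K₃ * (b * δ) ^ n) := by
          gcongr
          · exact (hNrate n).trans (by gcongr)
          · exact (hA n z h2).2.2
          · exact hErr n z h1 h2
      _ = _ := by ring
  have hanalytic : ∀ z : ℂ, ‖z‖ < (b * Δ₂)⁻¹ → z ≠ (b : ℂ)⁻¹ →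
      AnalyticAt ℂ (fun w => (((√N)⁻¹ : ℝ) : ℂ) * OPUC.szegoCont α b C w) z := fun z hz hne =>
    analyticAt_const.mul (h.analyticAt_szegoCont (hz.trans hball) hne)
  have hmer : MeromorphicAt (fun w => (((√N)⁻¹ : ℝ) : ℂ) * OPUC.szegoCont α b C w) (b : ℂ)⁻¹ :=
    (MeromorphicAt.const _ _).mul h.meromorphicAt_szegoCont
  -- D⁻¹ = H/√N is continued by the continuation of H. Here Δ₁ = δ, and Δ₂ is any number strictly
  -- between δ and 1.
  refine ⟨hSz, K₂ * K₀ + (√N)⁻¹ * K₃, δ, Δ₂,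
    fun w => (((√N)⁻¹ : ℝ) : ℂ) * OPUC.szegoCont α b C w, hδ, hΔ, hΔ1, ?_, ?_, ?_, ?_, ?_, ?_, ?_⟩
  · intro z hz
    beta_reduce
    rw [hD z hz, OPUC.szegoCont_eq_szegoLim (hz.trans ((one_lt_inv₀ hb0).2 hb1)), inv_div]
    push_cast
    rw [div_eq_inv_mul]
  · intro z hz
    by_cases hne : z = (b : ℂ)⁻¹
    · rw [hne]; exact hmer
    · exact (hanalytic z (mem_ball_zero_iff.1 hz) hne).meromorphicAt
  · exact fun z hz => hanalytic z (mem_ball_zero_iff.1 hz.1) hz.2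
  · intro hC
    have hconst : meromorphicOrderAt (fun _ : ℂ => (((√N)⁻¹ : ℝ) : ℂ)) (b : ℂ)⁻¹ = 0 := by
      rw [meromorphicOrderAt_const, if_neg hsC]
    have := meromorphicOrderAt_mul (MeromorphicAt.const (((√N)⁻¹ : ℝ) : ℂ) (b : ℂ)⁻¹)
      h.meromorphicAt_szegoCont
    rw [h.meromorphicOrderAt_szegoCont hC, hconst, zero_add] at this
    exact this
  · have hH := h.szegoLim_ne_zero (z := b) (by rw [hbn]; exact hb1.le)
    have ht := (h.tendsto_residue.const_mul (-(((√N)⁻¹ : ℝ) : ℂ))).mul_const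
      (conj (OPUC.szegoD μ b))
    have hv : -(((√N)⁻¹ : ℝ) : ℂ) * (-C * conj (OPUC.szegoLim α b)) * conj (OPUC.szegoD μ b)
        = C := by
      rw [hD b (by rw [hbn]; exact hb1), map_div₀, Complex.conj_ofReal]
      have h1 := (map_ne_zero (starRingEnd ℂ)).2 hH
      have h2 : (√N : ℂ) ≠ 0 := by exact_mod_cast (Real.sqrt_pos.2 hN).ne'
      push_cast
      field_simp
    rw [hv] at ht
    exact ht.congr fun z => by ring
  · intro n z h1 h2 hz
    -- Since b ≤ δ < Δ₂, the outer radius b/Δ₂ is at most 1, so the annulus lies in the disc where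
    -- `orthonormalOP_eval` applies.
    have hz1 : ‖z‖ ≤ 1 := h2.le.trans ((div_le_one hΔ0).2 (h.le.trans hΔ.le))
    refine le_trans (le_of_eq ?_) (hop n z h1 hz1)
    rw [OPUC.orthonormalOP_eval hμ h N n (hδΔ.trans h1) hz1 hz, OPUC.leadingTerm]
    congr 1
    ring
  · intro n
    -- Off b the leading term is φₙ minus the error, and both are continuous at b; the limit is
    -- therefore this value, and the error bound holds at b itself.
    refine ⟨(OPUC.orthonormalOP μ n).eval (b : ℂ) - OPUC.opError α b C N n b, ?_, ?_⟩
    · have hcont : ContinuousAt (fun z => (OPUC.orthonormalOP μ n).eval z -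
          OPUC.opError α b C N n z) b :=
        (Polynomial.continuousAt _).sub ((continuousAt_const.mul (Polynomial.continuousAt _)).add
          (continuousAt_const.mul (h.continuousAt_polyError n)))
      refine (hcont.tendsto.mono_left nhdsWithin_le_nhds).congr' ?_
      have hU : {z : ℂ | b * δ < ‖z‖ ∧ ‖z‖ < 1} ∈ 𝓝 (b : ℂ) :=
        (OPUC.isOpen_annulus _ _).mem_nhds ⟨by rw [hbn]; linarith, by rw [hbn]; exact hb1⟩
      filter_upwards [nhdsWithin_le_nhds hU, self_mem_nhdsWithin] with z hz hne
      rw [OPUC.orthonormalOP_eval hμ h N n hz.1 hz.2.le hne, add_sub_cancel_right]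
    · rw [sub_sub_cancel]
      exact hop n b (by rw [hbn]; exact hbΔ) (by rw [hbn]; exact hb1.le)
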